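/- Throughout, $I_s=\{1,\dots,s\}$ for $s\in\mathbb N=\{1,2,\dots\}$, and $\gamma=(\gamma_{s,u})_{s\in\mathbb N,\,u\subseteq I_s}$ are arbitrary non-negative real weights. **Discrepancy.** For points $x_0,\dots,x_{N-1}\in[0,1)^s$ put $\Delta(t)=\frac1N\#\{n: x_n\in[0,t_1)\times\dots\times[0,t_s)\}-t_1\cdots t_s$ (with first term $0$ if $N=0$), and $$\mathcal L_{2,N,\gamma}^2=\sum_{\emptyset\ne u\subseteq I_s}\gamma_{s,u}\int_{[0,1]^u}|\Delta(t_u,1)|^2\,dt_u ,$$ where $(t_u,1)$ has the components outside $u$ replaced by $1$. Scrambling a point set means Owen's scrambling: the dyadic digits $x_{j,1},x_{j,2},\dots$ of the $j$-th coordinate of every point are replaced by $y_{j,k}=\pi_{j,x_{j,1},\dots,x_{j,k-1}}(x_{j,k})$, where the $\pi_{j,a_1,\dots,a_{k-1}}$ are independent uniformly distributed random permutations of $\{0,1\}$. The mean square weighted $\mathcal L_2$ discrepancy is the expectation $\mathbb E[\mathcal L_{2,N,\gamma}^2]$ of the scrambled point set; for the empty point set $(N=0)$ it is denoted $\mathbb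 E[\mathcal L^2_{2,0,\gamma}]$. **Polynomial lattice rules.** Let $p\in\mathbb F_2[x]$ be irreducible with $\deg p=m\ge1$ and $q=(q_1,\dots,q_s)\in\mathbb F_2[x]^s$. The polynomial lattice point set $P_{2^m,s}(q,p)$ consists of the points $x_n=\bigl(v_m(n(x)q_j(x)/p(x))\bigr)_{j=1}^s$, $0\le n<2^m$, where $n(x)=\sum_i n_ix^i$ for $n=\sum_i n_i2^i$ in binary, and $v_m$ maps a Laurent series $\sum_{l\ge w} t_lx^{-l}\in\mathbb F_2((x^{-1}))$ to $\sum_{l=\max(1,w)}^m t_l2^{-l}$. **CBC construction.** Given $m$ and $s$, choose an irreducible $p$ with $\deg p=m$, set $q_1=1$, and for $\tau=2,\dots,s$ choose $q_\tau$ as a minimizer, over the non-zero polynomials of degree less than $m$ and with $q_1,\dots,q_{\tau-1}$ fixed, of $$B((q_1,\dots,q_\tau),\gamma)=\sum_{\emptyset\ne v\subseteq I_\tau}\Bigl(\sum_{v\subseteq u\subseteq I_s}\frac{\gamma_{s,u}}{3^{|u|}}\Bigr)\sum_{k}\ \prod_{j\in v}\psi(k_j),$$ where the inner sum is over all $k=(k_j)_{j\in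 v}\in\mathbb N^{v}$ with $\sum_{j\in v}\mathrm{tr}_m(k_j)\,q_j\equiv0\pmod p$; here $\mathrm{tr}_m(k)=\sum_{i<m}\kappa_ix^i$ for $k=\sum_i\kappa_i2^i$ in binary, and $\psi(k)=4^{-a}$ for $2^{a-1}\le k<2^a$. **Tractability.** Fix, for every $s,m\in\mathbb N$, an output $(p,q)$ of the CBC construction, and let $$N(s,\epsilon)=\min\{N=2^m:\ m\in\mathbb N,\ \mathbb E[\mathcal L_{2,N,\gamma}^2(\tilde P_{N,s})]\le\epsilon\,\mathbb E[\mathcal L^2_{2,0,\gamma}]\},$$ where $\tilde P_{2^m,s}$ is the scrambled $P_{2^m,s}(q,p)$. The discrepancy is strongly tractable with exponent $\beta\ge0$ if there is a constant $C\ge 0$, independent of $s$, $\epsilon$ and of the choices made in the constructions, such that $N(s,\epsilon)$ exists and $N(s,\epsilon)\le C\epsilon^{-\beta}$ for all $s\in\mathbb N$ and all $\epsilon\in(0,1)$. **Corollary.** Let $1/2<\lambda\le1$ and suppose that $$B_{\gamma,\lambda}:=\sup_{s\in\mathbb N}\frac{\Bigl[\sum_{\emptyset\ne u\subseteq I_s}\bigl(\frac{\gamma_{s,u}}{3^{|u|}}\bigr)^{\lambda}\Bigl(-1+\bigl(\frac{2^{2\lambda}-1}{2^{2\lambda}-2}\bigr)^{|u|}\Bigr)\Bigr]^{1/\lambda}}{\sum_{\emptyset\ne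 u\subseteq I_s}\frac{\gamma_{s,u}}{3^{|u|}}}<\infty$$ (a ratio $0/0$, which occurs only if $\gamma_{s,u}=0$ for all $\emptyset\ne u\subseteq I_s$, counts as $0$). Then the mean square weighted $\mathcal L_2$ discrepancy of the CBC-constructed scrambled polynomial lattice rules is strongly tractable with exponent $\lambda$; that is, its exponent of tractability is at most $\lambda$. -/

import Mathlib

open scoped ENNReal

noncomputable section

namespace PolyLattice

/-! ### The weighted `L₂` discrepancy -/

/-- Local discrepancy function `Δ(t) = A_N([0,t), P) / N - t₁ ⋯ tₛ` of the points
`x₀, …, x_{N-1}`. For the empty point set (`N = 0`) the first term is `0 / 0 = 0`, i.e.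
`Δ(t) = - t₁ ⋯ tₛ`, which is the usual convention for the initial discrepancy. -/
def localDiscrepancy {N s : ℕ} (x : Fin N → Fin s → ℝ) (t : Fin s → ℝ) : ℝ :=
  (Nat.card {n : Fin N // ∀ j, x n j ∈ Set.Ico 0 (t j)} : ℝ) / N - ∏ j, t j

/-- The vector `(t_u, 1)`: the components outside `u` are replaced by one. -/
def extendByOne {s : ℕ} (u : Finset (Fin s)) (t : u → ℝ) : Fin s → ℝ :=
  fun j => if h : j ∈ u then t ⟨j, h⟩ else 1

/-- The weighted `L₂` discrepancy with weights `γ_u`, `u ⊆ I_s`. -/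
def weightedL2 {N s : ℕ} (γ : Finset (Fin s) → ℝ) (x : Fin N → Fin s → ℝ) : ℝ :=
  Real.sqrt (∑ u : Finset (Fin s) with u.Nonempty,
    γ u * ∫ t in Set.Icc (0 : u → ℝ) 1, |localDiscrepancy x (extendByOne u t)| ^ 2)

/-! ### Polynomial lattice point sets -/

/-- `tr_m(k) = κ₀ + κ₁ x + ⋯ + κ_{m-1} x^{m-1}`, where the `κᵢ` are the binary digits of `k`. -/
def truncPoly (m k : ℕ) : Polynomial (ZMod 2) :=
  ∑ i ∈ Finset.range m, if k.testBit i then Polynomial.X ^ i else 0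

/-- The polynomial `k(x)` associated with the binary expansion of `k`. -/
def natPoly (k : ℕ) : Polynomial (ZMod 2) :=
  truncPoly k.size k

/-- The embedding of `𝔽₂[x]` into the field `𝔽₂((x⁻¹))`. The latter is realised as the field of
Laurent series in the variable `x⁻¹`, so that the coefficient of index `l` is that of `x^{-l}`
and `x` itself is the monomial of index `-1`. -/
def toLaurent (f : Polynomial (ZMod 2)) : LaurentSeries (ZMod 2) :=
  Polynomial.aeval (HahnSeries.single (-1 : ℤ) (1 : ZMod 2) : LaurentSeries (ZMod 2)) f

/-- `v_m (∑_l t_l x^{-l}) = ∑_{1 ≤ l ≤ m} t_l 2^{-l}`. -/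
def vMap (m : ℕ) (L : LaurentSeries (ZMod 2)) : ℝ :=
  ∑ l ∈ Finset.Icc 1 m, ((L.coeff (l : ℤ)).val : ℝ) / 2 ^ l

/-- The polynomial lattice point set `P_{2^m,s}(q, p)`. -/
def latticePoint {s : ℕ} (m : ℕ) (p : Polynomial (ZMod 2)) (q : Fin s → Polynomial (ZMod 2)) :
    Fin (2 ^ m) → Fin s → ℝ :=
  fun n j => vMap m (toLaurent (natPoly n) * toLaurent (q j) / toLaurent p)

/-! ### Owen's scrambling -/

/-- Every set of permutations of `{0, 1}` is measurable. -/
instance instMeasurableSpacePerm : MeasurableSpace (Equiv.Perm (Fin 2)) := ⊤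

/-- A scramble: a permutation `π_{j,a₁,…,a_{k-1}}` of `{0, 1}` for each coordinate `j` and each
finite sequence `a₁, …, a_{k-1}` of preceding digits. -/
abbrev Scramble (s : ℕ) : Type := Fin s × List (Fin 2) → Equiv.Perm (Fin 2)

/-- The law of the random scramble: all permutations are independent and uniform. -/
def scrambleLaw (s : ℕ) : MeasureTheory.Measure (Scramble s) :=
  MeasureTheory.Measure.infinitePi
    (fun _ => (PMF.uniformOfFintype (Equiv.Perm (Fin 2))).toMeasure)

/-- The scrambled point `y` of `x ∈ [0,1)^s`:
`y_{j,k} = π_{j,x_{j,1},…,x_{j,k-1}}(x_{j,k})`, where `x_{j,1}, x_{j,2}, …` are the dyadic digits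
of `x_j`. Here `Real.digits (x j) 2 k` is the digit `x_{j,k+1}`. -/
def scramblePoint {s : ℕ} (π : Scramble s) (x : Fin s → ℝ) : Fin s → ℝ :=
  fun j => Real.ofDigits fun k : ℕ =>
    π (j, List.ofFn fun i : Fin k => Real.digits (x j) 2 i) (Real.digits (x j) 2 k)

/-- The mean square weighted `L₂` discrepancy of the scrambled point set: all points of the
set are scrambled with the same random scramble. -/
def meanSquareL2 {N s : ℕ} (γ : Finset (Fin s) → ℝ) (x : Fin N → Fin s → ℝ) : ℝ :=
  ∫ π, weightedL2 γ (fun n => scramblePoint π (x n)) ^ 2 ∂(scrambleLaw s)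

/-- The mean square weighted `L₂` discrepancy of the empty point set. -/
def initialMeanSquareL2 {s : ℕ} (γ : Finset (Fin s) → ℝ) : ℝ :=
  meanSquareL2 γ (fun n : Fin 0 => n.elim0)

/-! ### The component-by-component construction -/

/-- The dual polynomial lattice `{k ∈ ℕ₀^s : tr_m(k) · q ≡ 0 (mod p)}`. -/
def dualLattice {s : ℕ} (m : ℕ) (p : Polynomial (ZMod 2)) (q : Fin s → Polynomial (ZMod 2)) :
    Set (Fin s → ℕ) :=
  {k | p ∣ ∑ j, truncPoly m (k j) * q j}

/-- `ψ(0) = 1` and `ψ(k) = 4^{-a}` for `2^{a-1} ≤ k < 2^a`. -/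
def psi (k : ℕ) : ℝ := 1 / 4 ^ k.size

/-- `γ̃_v = ∑_{v ⊆ u ⊆ I_s} γ_u / 3^{|u|}`. -/
def gammaTilde {s : ℕ} (γ : Finset (Fin s) → ℝ) (v : Finset (Fin s)) : ℝ :=
  ∑ u : Finset (Fin s) with v ⊆ u, γ u / 3 ^ u.card

/-- The quantity `B((q₁, …, q_τ), γ)`, i.e. the sum over nonempty `v ⊆ {1, …, τ}` of `γ̃_v` times
the sum of `ψ(k)` over all `k` in the dual lattice whose set of nonzero components is `v`, that
is, over all vectors `(k_v, 0)` in the dual lattice with `k_v` having positive components.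
Only the first `τ` components of `q` enter. -/
def criterion {s : ℕ} (γ : Finset (Fin s) → ℝ) (m : ℕ) (p : Polynomial (ZMod 2)) (τ : ℕ)
    (q : Fin s → Polynomial (ZMod 2)) : ℝ :=
  ∑ v : Finset (Fin s) with v.Nonempty ∧ ∀ j ∈ v, j.val < τ,
    gammaTilde γ v *
      ∑' k : {k : Fin s → ℕ // k ∈ dualLattice m p q ∧ ∀ j, k j ≠ 0 ↔ j ∈ v},
        ∏ j, psi (k.1 j)

/-- `R_m`: the nonzero polynomials over `𝔽₂` of degree less than `m`. -/
def candidates (m : ℕ) : Set (Polynomial (ZMod 2)) :=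
  {r | r ≠ 0 ∧ r.degree < m}

/-- `(p, q)` is a possible output of the component-by-component construction with general
weights `γ`: `p` is irreducible of degree `m`, `q₁ = 1`, and for `τ = 2, …, s` the component
`q_τ ∈ R_m` minimises `B((q₁, …, q_{τ-1}, q_τ), γ)` over `R_m`. (The coordinate `τ` has index
`j = τ - 1` in `Fin s`.) -/
structure IsCBC {s : ℕ} (γ : Finset (Fin s) → ℝ) (m : ℕ) (p : Polynomial (ZMod 2))
    (q : Fin s → Polynomial (ZMod 2)) : Prop where
  irreducible : Irreducible p
  natDegree_eq : p.natDegree = m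
  first : ∀ j : Fin s, j.val = 0 → q j = 1
  mem : ∀ j : Fin s, q j ∈ candidates m
  minimal : ∀ j : Fin s, 0 < j.val → ∀ r ∈ candidates m,
    criterion γ m p (j.val + 1) q ≤ criterion γ m p (j.val + 1) (Function.update q j r)

/-! ### Tractability -/

/-- The set of all `N = 2^m`, `m ≥ 1`, for which the scrambled polynomial lattice point set given
by the `m`-th pair `(p, q)` reduces the initial mean square discrepancy by the factor `ε`. The
inverse `N(s, ε)` is the minimum of this set. -/
def goodSizes {s : ℕ} (γ : Finset (Fin s) → ℝ) (p : ℕ → Polynomial (ZMod 2))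
    (q : ℕ → Fin s → Polynomial (ZMod 2)) (ε : ℝ) : Set ℕ :=
  {N | ∃ m : ℕ, 1 ≤ m ∧ N = 2 ^ m ∧
    meanSquareL2 γ (latticePoint m (p m) (q m)) ≤ ε * initialMeanSquareL2 γ}

/-- The mean square weighted `L₂` discrepancy of the CBC-constructed scrambled polynomial lattice
rules is strongly tractable with exponent `β`: there is a constant `C` such that, whatever
irreducible polynomials are chosen and however ties are broken in the construction, the inverse
`N(s, ε)` exists and is at most `C ε^{-β}` for all `s ≥ 1` and `0 < ε < 1`. -/
def StronglyTractable (γ : (s : ℕ) → Finset (Fin s) → ℝ) (β : ℝ) : Prop :=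
  0 ≤ β ∧ ∃ C : ℝ, 0 ≤ C ∧
    ∀ (s : ℕ), 1 ≤ s →
    ∀ (p : ℕ → Polynomial (ZMod 2)) (q : ℕ → Fin s → Polynomial (ZMod 2)),
      (∀ m, 1 ≤ m → IsCBC (γ s) m (p m) (q m)) →
      ∀ ε : ℝ, 0 < ε → ε < 1 →
        ∃ N : ℕ, IsLeast (goodSizes (γ s) p q ε) N ∧ (N : ℝ) ≤ C * ε ^ (-β)

/-- The ratio whose supremum over `s` is `B_{γ,λ}`. -/
def weightRatio {s : ℕ} (γ : Finset (Fin s) → ℝ) (lam : ℝ) : ℝ :=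
  (∑ u : Finset (Fin s) with u.Nonempty,
      (γ u / 3 ^ u.card) ^ lam *
        (-1 + (((2 : ℝ) ^ (2 * lam) - 1) / ((2 : ℝ) ^ (2 * lam) - 2)) ^ u.card)) ^ (1 / lam) /
    ∑ u : Finset (Fin s) with u.Nonempty, γ u / 3 ^ u.card

/-- `B_{γ,λ}`, the supremum over all `s ≥ 1`, as an extended real number. -/
def weightConst (γ : (s : ℕ) → Finset (Fin s) → ℝ) (lam : ℝ) : EReal :=
  ⨆ (s : ℕ) (_ : 1 ≤ s), (weightRatio (γ s) lam : EReal)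

end PolyLattice

end

/-!
Averaging over Owen's scrambling turns the kernel of the squared discrepancy into a product of Walsh
series with coefficients `ψ`. Summing the Walsh functions over the lattice points keeps only the
frequencies of the dual lattice, so the mean square discrepancy equals the criterion that the CBC
construction minimizes.

A minimum is at most an average. Since `x ↦ x ^ λ` is subadditive for `λ ≤ 1`, the average of the
`λ`-th powers over the `2 ^ m - 1` candidates for a component is bounded by a sum over the
frequencies `k` that are dual for some candidate. Such a frequency is dual for only one of them,
unless `2 ^ m` divides its component `k_j`; then `ψ (k_j) ^ λ` is smaller by a factor of at least
`2 ^ m` than `ψ (k_j / 2 ^ m) ^ λ`. Hence `2 ^ m - 1` times the `λ`-th power of the criterion is at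
most the sum over all nonzero frequencies, which is the sum in the numerator of `B_{γ,λ}`.
-/

open MeasureTheory ProbabilityTheory

namespace PolyLattice

/-! ### Series -/

theorem hasSum_pi_prod {n : ℕ} {α R : Type*} [NormedCommRing R] [CompleteSpace R]
    (f : Fin n → α → R) (hf : ∀ i, Summable fun a => ‖f i a‖) :
    (Summable fun k : Fin n → α => ‖∏ i, f i (k i)‖) ∧
      HasSum (fun k : Fin n → α => ∏ i, f i (k i)) (∏ i, ∑' a, f i a) := by
  induction n with
  | zero => exact ⟨(hasSum_unique _).summable, by simp⟩
  | succ n ih =>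
    obtain ⟨hnorm, hsum⟩ := ih (fun i => f i.succ) fun i => hf i.succ
    let e : α × (Fin n → α) ≃ (Fin (n + 1) → α) := Fin.consEquiv fun _ => α
    let g (k : Fin n → α) : R := ∏ i, f i.succ (k i)
    have hprod (x : α × (Fin n → α)) : f 0 x.1 * g x.2 = ∏ i, f i (e x i) :=
      (Fin.prod_univ_succ fun i => f i (e x i)).symm
    have hmul : Summable fun x : α × (Fin n → α) => ‖f 0 x.1 * g x.2‖ :=
      Summable.mul_norm (f := f 0) (g := g) (hf 0) hnorm
    have hsum_mul := HasSum.mul (f := f 0) (g := g) (hf 0).of_norm.hasSum hsum hmul.of_norm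
    simp only [hprod] at hmul hsum_mul
    rw [Fin.prod_univ_succ]
    exact ⟨e.summable_iff.1 hmul, e.hasSum_iff.1 hsum_mul⟩

theorem hasSum_indicator_prod {n : ℕ} {R : Type*} [NormedCommRing R] [CompleteSpace R]
    {f : Fin n → ℕ → R} (hf : ∀ i, Summable fun k => ‖f i k‖) (h0 : ∀ i, f i 0 = 1)
    (u : Finset (Fin n)) :
    HasSum ({k : Fin n → ℕ | ∀ i ∉ u, k i = 0}.indicator fun k => ∏ i, f i (k i))
      (∏ i ∈ u, ∑' k, f i k) := by
  let g (i : Fin n) : ℕ → R := if i ∈ u then f i else Pi.single 0 1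
  have hg (i : Fin n) : Summable fun k => ‖g i k‖ := by
    by_cases hi : i ∈ u
    · simpa only [g, hi, if_true] using hf i
    · refine (hasSum_single 0 fun k hk => ?_).summable
      simp [g, hi, hk]
  convert (hasSum_pi_prod g hg).2 using 1
  · funext k
    by_cases hk : ∀ i ∉ u, k i = 0
    · rw [Set.indicator_of_mem (by exact hk)]
      refine Finset.prod_congr rfl fun i _ => ?_
      by_cases hi : i ∈ u <;> simp [g, hi, hk, h0]
    · rw [Set.indicator_of_notMem (by exact hk)]
      push Not at hk
      obtain ⟨i, hi, hki⟩ := hk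
      exact (Finset.prod_eq_zero (Finset.mem_univ i) (by simp [g, hi, hki])).symm
  · rw [← Finset.prod_subset (Finset.subset_univ u) fun i _ hi => ?_]
    · exact Finset.prod_congr rfl fun i hi => by simp only [g, hi, if_true]
    · simp [g, hi]

theorem tsum_of_binary_recursion {𝕜 : Type*} [NormedField 𝕜] [CompleteSpace 𝕜]
    {f g : ℕ → 𝕜} (hf : Summable f) (hg : Summable g) {a b : 𝕜}
    (heven : ∀ k ≠ 0, f (2 * k) = a * g k) (hodd : ∀ k, f (2 * k + 1) = b * g k) :
    ∑' k, f k = f 0 - a * g 0 + (a + b) * ∑' k, g k := by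
  have hfeven : Summable fun k => f (2 * k) := hf.comp_injective (mul_right_injective₀ two_ne_zero)
  have hfodd : Summable fun k => f (2 * k + 1) :=
    hf.comp_injective ((add_left_injective 1).comp (mul_right_injective₀ two_ne_zero))
  have hsplit := tsum_even_add_odd hfeven hfodd
  rw [hfeven.tsum_eq_zero_add] at hsplit
  simp only [hodd, heven _ (Nat.succ_ne_zero _), tsum_mul_left, mul_zero] at hsplit
  rw [← hsplit, hg.tsum_eq_zero_add]
  ring

theorem rpow_tsum_le_tsum_rpow {ι : Type*} (f : ι → ℝ≥0∞) {r : ℝ} (h0 : 0 < r) (h1 : r ≤ 1) :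
    (∑' i, f i) ^ r ≤ ∑' i, f i ^ r := by
  rw [← ENNReal.le_rpow_inv_iff h0, ENNReal.tsum_eq_iSup_sum]
  refine iSup_le fun t => ?_
  rw [ENNReal.le_rpow_inv_iff h0]
  calc (∑ i ∈ t, f i) ^ r ≤ ∑ i ∈ t, f i ^ r :=
        Finset.le_sum_of_subadditive (fun x : ℝ≥0∞ => x ^ r) (by simp [h0])
          (fun x y => ENNReal.rpow_add_le_add_rpow x y h0.le h1) t f
    _ ≤ ∑' i, f i ^ r := ENNReal.sum_le_tsum t

theorem exists_isLeast_two_pow_le {P : ℕ → Prop} {K : ℝ} (hK : 0 ≤ K)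
    (hP : ∀ m, K ≤ 2 ^ m → P (m + 1)) :
    ∃ N : ℕ, IsLeast {N | ∃ m, 1 ≤ m ∧ N = 2 ^ m ∧ P m} N ∧ (N : ℝ) ≤ 2 + 4 * K := by
  classical
  have hex : ∃ m, P (m + 1) :=
    let ⟨m, hm⟩ := pow_unbounded_of_one_lt K one_lt_two
    ⟨m, hP m hm.le⟩
  refine ⟨2 ^ (Nat.find hex + 1), ⟨⟨_, by lia, rfl, Nat.find_spec hex⟩, ?_⟩, ?_⟩
  · rintro _ ⟨m, hm, rfl, hPm⟩
    obtain ⟨l, rfl⟩ := Nat.exists_eq_add_of_le' hm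
    exact pow_le_pow_right₀ one_le_two (Nat.add_le_add_right (Nat.find_min' hex hPm) 1)
  · rcases hfind : Nat.find hex with _ | l
    · norm_num
      exact hK
    · have hlt : (2 : ℝ) ^ l < K := by
        by_contra! hle
        exact Nat.find_min hex (hfind ▸ l.lt_succ_self) (hP l hle)
      push_cast [pow_succ]
      linarith

/-! ### Digit expansions -/

theorem mul_ofDigits {b : ℕ} (a : ℕ → Fin b) :
    b * Real.ofDigits a = (a 0 : ℕ) + Real.ofDigits fun k => a (k + 1) := by
  have hb : (b : ℝ) ≠ 0 := by exact_mod_cast (a 0).pos.ne'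
  rw [Real.ofDigits_eq_sum_add_ofDigits a 1]
  simp only [Finset.sum_range_one, Real.ofDigitsTerm, zero_add, pow_one]
  field_simp

theorem ofDigits_lt_one {b : ℕ} {a : ℕ → Fin b} {k : ℕ} (hk : (a k : ℕ) + 1 < b) :
    Real.ofDigits a < 1 := by
  have hb : (0 : ℝ) < b := by exact_mod_cast (a 0).pos
  suffices b * Real.ofDigits a < b * 1 from lt_of_mul_lt_mul_left this hb.le
  rw [mul_ofDigits, mul_one]
  induction k generalizing a with
  | zero =>
    have h0 : ((a 0 : ℕ) : ℝ) + 1 < b := by exact_mod_cast hk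
    linarith [Real.ofDigits_le_one fun k => a (k + 1)]
  | succ k ih =>
    have h0 : ((a 0 : ℕ) : ℝ) + 1 ≤ b := by exact_mod_cast (a 0).isLt
    have h1 := ih (a := fun k => a (k + 1)) hk
    simp only [← mul_ofDigits fun k => a (k + 1)] at h1
    linarith [(mul_lt_iff_lt_one_right hb).1 h1]

theorem ofDigits_le_ofDigits {b : ℕ} {a a' : ℕ → Fin b} {i : ℕ} (h : ∀ k < i, a k = a' k)
    (hi : a i < a' i) : Real.ofDigits a ≤ Real.ofDigits a' := by
  have hb : (0 : ℝ) < b := by exact_mod_cast (a 0).pos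
  induction i generalizing a a' with
  | zero =>
    refine le_of_mul_le_mul_left ?_ hb
    have hi : ((a 0 : ℕ) : ℝ) + 1 ≤ (a' 0 : ℕ) := by exact_mod_cast hi
    rw [mul_ofDigits, mul_ofDigits]
    linarith [Real.ofDigits_le_one fun k => a (k + 1), Real.ofDigits_nonneg fun k => a' (k + 1)]
  | succ i ih =>
    refine le_of_mul_le_mul_left ?_ hb
    rw [mul_ofDigits, mul_ofDigits, h 0 i.succ_pos]
    gcongr
    exact ih (fun k hk => h (k + 1) (Nat.succ_lt_succ hk)) hi

theorem exists_ofDigits_mul_pow_succ_eq {b : ℕ} (a : ℕ → Fin b) (i : ℕ) :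
    ∃ A : ℕ, Real.ofDigits a * b ^ (i + 1) =
      (b * A + a i : ℕ) + Real.ofDigits fun k => a (k + (i + 1)) := by
  induction i generalizing a with
  | zero => exact ⟨0, by simpa [mul_comm] using mul_ofDigits a⟩
  | succ i ih =>
    obtain ⟨A, hA⟩ := ih fun k => a (k + 1)
    refine ⟨a 0 * b ^ i + A, ?_⟩
    have hshift (k : ℕ) : k + (i + 1) + 1 = k + (i + 1 + 1) := rfl
    rw [pow_succ', ← mul_assoc, mul_comm _ (b : ℝ), mul_ofDigits, add_mul, hA]
    simp only [hshift]
    push_cast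
    ring

theorem digits_ofDigits {b : ℕ} [NeZero b] {a : ℕ → Fin b}
    (h : ∀ n, ∃ k, (a (k + n) : ℕ) + 1 < b) : Real.digits (Real.ofDigits a) b = a := by
  funext i
  obtain ⟨A, hA⟩ := exists_ofDigits_mul_pow_succ_eq a i
  obtain ⟨k, hk⟩ := h (i + 1)
  have hlt : Real.ofDigits (fun k => a (k + (i + 1))) < 1 := ofDigits_lt_one hk
  have hfloor : ⌊Real.ofDigits a * b ^ (i + 1)⌋₊ = b * A + a i := by
    rw [hA, add_comm, Nat.floor_add_natCast (Real.ofDigits_nonneg _), Nat.floor_eq_zero.2 hlt,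
      zero_add]
  ext
  rw [Real.digits, hfloor, Fin.val_ofNat, Nat.mul_add_mod, Nat.mod_eq_of_lt (a i).isLt]

/-! ### Scrambling a single coordinate -/

instance : DiscreteMeasurableSpace (Equiv.Perm (Fin 2)) := ⟨fun _ => trivial⟩

/-- The uniform distribution on the permutations of `{0, 1}`. -/
noncomputable def permLaw : Measure (Equiv.Perm (Fin 2)) :=
  (PMF.uniformOfFintype (Equiv.Perm (Fin 2))).toMeasure

instance : IsProbabilityMeasure permLaw := by unfold permLaw; infer_instance

/-- A scramble of a single coordinate: a permutation for each node of the binary tree, a node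
being the list of the digits that lead to it. -/
abbrev TreeScramble : Type := List (Fin 2) → Equiv.Perm (Fin 2)

/-- The law of the random scramble of a single coordinate. -/
noncomputable def treeLaw : Measure TreeScramble := Measure.infinitePi fun _ => permLaw

instance : IsProbabilityMeasure treeLaw := by unfold treeLaw; infer_instance

/-- The node reached after the first `k` digits. -/
def digitPrefix (d : ℕ → Fin 2) (k : ℕ) : List (Fin 2) := List.ofFn fun i : Fin k => d i

/-- The digits that a scramble makes of the digits `d`. -/
def scrambleDigits (π : TreeScramble) (d : ℕ → Fin 2) : ℕ → Fin 2 :=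
  fun k => π (digitPrefix d k) (d k)

/-- The real number in `[0, 1]` with the scrambled digits. -/
noncomputable def scrambleReal (d : ℕ → Fin 2) (π : TreeScramble) : ℝ :=
  Real.ofDigits (scrambleDigits π d)

/-- The signs `1, -1` of the digits `0, 1`. -/
def digitSign (a : Fin 2) : ℝ := (-1) ^ (a : ℕ)

/-- The sign of a permutation as a real number. -/
def permSign (σ : Equiv.Perm (Fin 2)) : ℝ := (Equiv.Perm.sign σ : ℤ)

lemma digitSign_mul_self (a : Fin 2) : digitSign a * digitSign a = 1 := by
  rw [digitSign, ← mul_pow]; simp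

lemma abs_digitSign (a : Fin 2) : |digitSign a| = 1 := by simp [digitSign]

lemma digitSign_of_ne {a b : Fin 2} (h : a ≠ b) : digitSign b = -digitSign a := by
  fin_cases a <;> fin_cases b <;> simp_all [digitSign]

lemma natCast_eq_digitSign (a : Fin 2) : ((a : ℕ) : ℝ) = (1 - digitSign a) / 2 := by
  fin_cases a <;> norm_num [digitSign]

lemma permSign_mul_self (σ : Equiv.Perm (Fin 2)) : permSign σ * permSign σ = 1 := by
  rw [permSign, ← Int.cast_mul, ← Units.val_mul, Int.units_mul_self, Units.val_one, Int.cast_one]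

lemma abs_permSign (σ : Equiv.Perm (Fin 2)) : |permSign σ| = 1 := by
  rcases mul_self_eq_one_iff.1 (permSign_mul_self σ) with h | h <;> simp [h]

lemma digitSign_apply (σ : Equiv.Perm (Fin 2)) (a : Fin 2) :
    digitSign (σ a) = digitSign a * permSign σ := by
  have h : ∀ (σ : Equiv.Perm (Fin 2)) (a : Fin 2),
      (-1 : ℤ) ^ (σ a : ℕ) = (-1) ^ (a : ℕ) * Equiv.Perm.sign σ := by decide
  rw [digitSign, digitSign, permSign]
  exact_mod_cast h σ a

lemma digitPrefix_injective (d : ℕ → Fin 2) : Function.Injective (digitPrefix d) := fun k l h => by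
  simpa [digitPrefix] using congrArg List.length h

lemma digitPrefix_congr {d d' : ℕ → Fin 2} {k : ℕ} (h : ∀ i < k, d i = d' i) :
    digitPrefix d k = digitPrefix d' k :=
  congrArg List.ofFn (funext fun i => h i i.2)

lemma univ_perm_fin_two : (Finset.univ : Finset (Equiv.Perm (Fin 2))) = {1, Equiv.swap 0 1} := by
  decide

lemma integral_permSign : ∫ σ, permSign σ ∂permLaw = 0 := by
  rw [permLaw, PMF.integral_eq_sum, univ_perm_fin_two, Finset.sum_pair (by decide)]
  simp [permSign]

lemma permLaw_apply_eq_one (a : Fin 2) : permLaw {σ | σ a = 1} = 1 / 2 := by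
  rw [permLaw, PMF.toMeasure_apply_fintype, univ_perm_fin_two, Finset.sum_pair (by decide)]
  fin_cases a <;> simp [Set.indicator_apply, Fintype.card_perm]

lemma measurable_permSign_apply (l : List (Fin 2)) :
    Measurable fun π : TreeScramble => permSign (π l) :=
  (measurable_from_top (f := permSign)).comp (measurable_pi_apply l)

lemma integral_permSign_apply (l : List (Fin 2)) : ∫ π, permSign (π l) ∂treeLaw = 0 := by
  have h := measurePreserving_eval_infinitePi (fun _ : List (Fin 2) => permLaw) l
  rw [← integral_permSign, ← h.map_eq,
    integral_map h.measurable.aemeasurable Measurable.of_discrete.aestronglyMeasurable]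
  rfl

lemma integral_permSign_mul (l l' : List (Fin 2)) :
    ∫ π, permSign (π l) * permSign (π l') ∂treeLaw = if l = l' then 1 else 0 := by
  split_ifs with h
  · simp [h, permSign_mul_self]
  · have hindep := (iIndepFun_infinitePi (P := fun _ : List (Fin 2) => permLaw)
      (X := fun _ σ => permSign σ) fun _ => measurable_from_top).indepFun h
    refine (hindep.integral_mul_eq_mul_integral (measurable_permSign_apply l).aestronglyMeasurable
      (measurable_permSign_apply l').aestronglyMeasurable).trans ?_
    exact mul_eq_zero_of_left (integral_permSign_apply l) _

/-- The signed series `∑ 2^{-k} (-1)^{y_k}` of the scrambled digits `y₁, y₂, …`. -/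
noncomputable def signSum (d : ℕ → Fin 2) (π : TreeScramble) : ℝ :=
  ∑' k : ℕ, (1 / 2 : ℝ) ^ (k + 1) * digitSign (d k) * permSign (π (digitPrefix d k))

lemma hasSum_half_pow : HasSum (fun k : ℕ => (1 / 2 : ℝ) ^ (k + 1)) 1 := by
  simpa [pow_succ', div_eq_mul_inv] using hasSum_geometric_two' 1

lemma norm_signSum_term (d : ℕ → Fin 2) (π : TreeScramble) (k : ℕ) :
    ‖(1 / 2 : ℝ) ^ (k + 1) * digitSign (d k) * permSign (π (digitPrefix d k))‖ =
      (1 / 2) ^ (k + 1) := by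
  rw [norm_mul, norm_mul, Real.norm_eq_abs (digitSign _), Real.norm_eq_abs (permSign _),
    abs_digitSign, abs_permSign, mul_one, mul_one, Real.norm_of_nonneg (by positivity)]

lemma hasSum_signSum (d : ℕ → Fin 2) (π : TreeScramble) :
    HasSum (fun k : ℕ => (1 / 2 : ℝ) ^ (k + 1) * digitSign (d k) * permSign (π (digitPrefix d k)))
      (signSum d π) :=
  (Summable.of_norm_bounded hasSum_half_pow.summable fun k => (norm_signSum_term d π k).le).hasSum

lemma scrambleReal_eq (d : ℕ → Fin 2) (π : TreeScramble) :
    scrambleReal d π = (1 - signSum d π) / 2 := by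
  refine HasSum.tsum_eq ?_
  convert! (hasSum_half_pow.sub (hasSum_signSum d π)).div_const 2 using 1
  funext k
  rw [Real.ofDigitsTerm, natCast_eq_digitSign, scrambleDigits, digitSign_apply]
  simp only [Nat.cast_ofNat, one_div, inv_pow]
  ring

lemma measurable_scrambleReal (d : ℕ → Fin 2) : Measurable (scrambleReal d) :=
  Real.continuous_ofDigits.measurable.comp <| measurable_pi_lambda _ fun k =>
    (measurable_from_top (f := fun σ : Equiv.Perm (Fin 2) => σ (d k))).comp (measurable_pi_apply _)

lemma scrambleReal_nonneg (d : ℕ → Fin 2) (π : TreeScramble) : 0 ≤ scrambleReal d π :=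
  Real.ofDigits_nonneg _

lemma scrambleReal_le_one (d : ℕ → Fin 2) (π : TreeScramble) : scrambleReal d π ≤ 1 :=
  Real.ofDigits_le_one _

lemma integrable_scrambleReal (d : ℕ → Fin 2) : Integrable (scrambleReal d) treeLaw :=
  .of_bound (measurable_scrambleReal d).aestronglyMeasurable 1 <| .of_forall fun π => by
    rw [Real.norm_of_nonneg (scrambleReal_nonneg d π)]
    exact scrambleReal_le_one d π

lemma signSum_eq (d : ℕ → Fin 2) (π : TreeScramble) : signSum d π = 1 - 2 * scrambleReal d π := by
  rw [scrambleReal_eq]; ring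

lemma measurable_signSum (d : ℕ → Fin 2) : Measurable (signSum d) := by
  simp only [funext (signSum_eq d)]
  exact ((measurable_scrambleReal d).const_mul 2).const_sub 1

lemma abs_signSum_le (d : ℕ → Fin 2) (π : TreeScramble) : |signSum d π| ≤ 1 := by
  rw [signSum_eq, abs_le]
  constructor <;> linarith [scrambleReal_nonneg d π, scrambleReal_le_one d π]

lemma integrable_signSum (d : ℕ → Fin 2) : Integrable (signSum d) treeLaw :=
  .of_bound (measurable_signSum d).aestronglyMeasurable 1 (.of_forall (abs_signSum_le d))

lemma integrable_signSum_sq (d : ℕ → Fin 2) : Integrable (fun π => signSum d π ^ 2) treeLaw :=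
  .of_bound ((measurable_signSum d).pow_const 2).aestronglyMeasurable 1 <| .of_forall fun π => by
    rw [norm_pow]
    exact pow_le_one₀ (norm_nonneg _) (abs_signSum_le d π)

lemma integrable_permSign_mul_signSum (l : List (Fin 2)) (d : ℕ → Fin 2) :
    Integrable (fun π => permSign (π l) * signSum d π) treeLaw :=
  .of_bound ((measurable_permSign_apply l).mul (measurable_signSum d)).aestronglyMeasurable 1 <|
    .of_forall fun π => by
      rw [Real.norm_eq_abs, abs_mul, abs_permSign, one_mul]
      exact abs_signSum_le d π

lemma hasSum_integral_mul_signSum (d : ℕ → Fin 2) {g : TreeScramble → ℝ} (hg : Measurable g)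
    (hg1 : ∀ π, |g π| ≤ 1) :
    HasSum (fun k : ℕ => (1 / 2 : ℝ) ^ (k + 1) * digitSign (d k) *
      ∫ π, g π * permSign (π (digitPrefix d k)) ∂treeLaw) (∫ π, g π * signSum d π ∂treeLaw) := by
  have hmeas (k : ℕ) : Measurable fun π : TreeScramble =>
      g π * ((1 / 2 : ℝ) ^ (k + 1) * digitSign (d k) * permSign (π (digitPrefix d k))) :=
    hg.mul ((measurable_permSign_apply _).const_mul _)
  have key := hasSum_integral_of_dominated_convergence (μ := treeLaw)
    (fun k _ => (1 / 2 : ℝ) ^ (k + 1)) (fun k => (hmeas k).aestronglyMeasurable)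
    (fun k => .of_forall fun π => ?_) (.of_forall fun _ => hasSum_half_pow.summable)
    (integrable_const _) (.of_forall fun π => (hasSum_signSum d π).mul_left (g π))
  · simpa only [mul_left_comm (g _), integral_const_mul] using key
  · rw [norm_mul, norm_signSum_term]
    exact mul_le_of_le_one_left (by positivity) (hg1 π)

lemma integral_signSum (d : ℕ → Fin 2) : ∫ π, signSum d π ∂treeLaw = 0 := by
  have h := hasSum_integral_mul_signSum d (g := fun _ => 1) measurable_const (by simp)
  simp only [one_mul, integral_permSign_apply, mul_zero] at h
  exact h.unique hasSum_zero

lemma integral_permSign_mul_signSum (d : ℕ → Fin 2) (k : ℕ) :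
    ∫ π, permSign (π (digitPrefix d k)) * signSum d π ∂treeLaw =
      (1 / 2 : ℝ) ^ (k + 1) * digitSign (d k) := by
  have h := hasSum_integral_mul_signSum d (measurable_permSign_apply (digitPrefix d k))
    fun π => (abs_permSign _).le
  simp only [integral_permSign_mul, (digitPrefix_injective d).eq_iff] at h
  refine h.unique ?_
  convert! hasSum_single (f := fun l => (1 / 2 : ℝ) ^ (l + 1) * digitSign (d l) *
    if k = l then 1 else 0) k fun l hl => by simp [hl.symm] using 1
  simp

lemma integral_signSum_sq (d : ℕ → Fin 2) : ∫ π, signSum d π ^ 2 ∂treeLaw = 1 / 3 := by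
  have h := hasSum_integral_mul_signSum d (measurable_signSum d) (abs_signSum_le d)
  simp_rw [mul_comm (signSum d _) (permSign _), integral_permSign_mul_signSum] at h
  have hterm (k : ℕ) : (1 / 2 : ℝ) ^ (k + 1) * digitSign (d k) *
      ((1 / 2 : ℝ) ^ (k + 1) * digitSign (d k)) = 1 / 4 * (1 / 4) ^ k := by
    calc _ = (1 / 2 : ℝ) ^ (k + 1) * (1 / 2) ^ (k + 1) * (digitSign (d k) * digitSign (d k)) := by
          ring
      _ = _ := by rw [digitSign_mul_self, mul_one, ← mul_pow, pow_succ']; norm_num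
  simp_rw [hterm] at h
  simp_rw [pow_two]
  refine h.unique ?_
  convert! (hasSum_geometric_of_lt_one (r := 1 / 4) (by norm_num) (by norm_num)).mul_left _ using 1
  norm_num

lemma integral_one_sub_scrambleReal (d : ℕ → Fin 2) :
    ∫ π, (1 - scrambleReal d π) ∂treeLaw = 1 / 2 := by
  have h (π : TreeScramble) : 1 - scrambleReal d π = 1 / 2 + 1 / 2 * signSum d π := by
    rw [scrambleReal_eq]; ring
  simp_rw [h]
  rw [integral_add (integrable_const _) ((integrable_signSum d).const_mul _), integral_const_mul,
    integral_signSum]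
  simp

lemma one_sub_scrambleReal_sq (d : ℕ → Fin 2) (π : TreeScramble) :
    (1 - scrambleReal d π ^ 2) / 2 =
      3 / 8 + 1 / 4 * signSum d π - 1 / 8 * signSum d π ^ 2 := by
  rw [scrambleReal_eq]; ring

lemma integrable_one_sub_scrambleReal_sq (d : ℕ → Fin 2) :
    Integrable (fun π => (1 - scrambleReal d π ^ 2) / 2) treeLaw := by
  simp only [one_sub_scrambleReal_sq]
  exact ((integrable_const _).add ((integrable_signSum d).const_mul _)).sub
    ((integrable_signSum_sq d).const_mul _)

lemma integral_one_sub_scrambleReal_sq (d : ℕ → Fin 2) :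
    ∫ π, (1 - scrambleReal d π ^ 2) / 2 ∂treeLaw = 1 / 3 := by
  have h1 := integrable_signSum d
  have h2 := integrable_signSum_sq d
  simp only [one_sub_scrambleReal_sq]
  rw [integral_sub (by fun_prop) (by fun_prop), integral_add (by fun_prop) (by fun_prop),
    integral_const_mul, integral_const_mul, integral_signSum, integral_signSum_sq]
  norm_num

lemma ae_scrambleReal_lt_one (d : ℕ → Fin 2) : ∀ᵐ π ∂treeLaw, scrambleReal d π < 1 := by
  rw [ae_iff]
  have hle (n : ℕ) : treeLaw {π | ¬ scrambleReal d π < 1} ≤ (1 / 2 : ℝ≥0∞) ^ n := by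
    let t (l : List (Fin 2)) : Set (Equiv.Perm (Fin 2)) := {σ | σ (d l.length) = 1}
    calc treeLaw {π | ¬ scrambleReal d π < 1}
        ≤ treeLaw (Set.pi ((Finset.range n).image (digitPrefix d)) t) := by
          refine measure_mono fun π hπ l hl => ?_
          obtain ⟨k, -, rfl⟩ := Finset.mem_image.1 (Finset.mem_coe.1 hl)
          have hk : ¬ (scrambleDigits π d k : ℕ) + 1 < 2 := fun hk => hπ (ofDigits_lt_one hk)
          simp only [t, digitPrefix, List.length_ofFn, Set.mem_ofPred_eq]
          simp only [scrambleDigits, digitPrefix] at hk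
          lia
      _ = (1 / 2 : ℝ≥0∞) ^ n := by
          rw [treeLaw, Measure.infinitePi_pi _ fun _ _ => MeasurableSet.of_discrete,
            Finset.prod_image fun _ _ _ _ h => digitPrefix_injective d h]
          simp only [t, permLaw_apply_eq_one, Finset.prod_const, Finset.card_range]
  refine le_antisymm (ge_of_tendsto' (ENNReal.tendsto_pow_atTop_nhds_zero_of_lt_one ?_) hle)
    zero_le
  rw [one_div]
  exact ENNReal.one_half_lt_one

lemma scrambleDigits_congr {d d' : ℕ → Fin 2} {i : ℕ} (h : ∀ k < i, d k = d' k)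
    (π : TreeScramble) : ∀ k < i, scrambleDigits π d k = scrambleDigits π d' k := fun k hk => by
  rw [scrambleDigits, scrambleDigits, h k hk, digitPrefix_congr fun l hl => h l (hl.trans hk)]

/-- At the first difference of `d` and `d'` both digits are permuted by the same permutation, and
this decides the order of the scrambled values. -/
lemma max_scrambleReal {d d' : ℕ → Fin 2} {i : ℕ} (h : ∀ k < i, d k = d' k) (hi : d i ≠ d' i)
    (π : TreeScramble) :
    max (scrambleReal d π) (scrambleReal d' π) = (scrambleReal d π + scrambleReal d' π) / 2 -
      digitSign (scrambleDigits π d i) * (scrambleReal d π - scrambleReal d' π) / 2 := by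
  have hcongr := scrambleDigits_congr h π
  have hne : scrambleDigits π d i ≠ scrambleDigits π d' i := by
    rw [scrambleDigits, scrambleDigits, digitPrefix_congr h]
    exact (π _).injective.ne hi
  rcases hne.lt_or_gt with hlt | hlt
  · have h0 : scrambleDigits π d i = 0 := by lia
    have hle : scrambleReal d π ≤ scrambleReal d' π := ofDigits_le_ofDigits hcongr hlt
    rw [max_eq_right hle, h0, digitSign]
    simp only [Fin.val_zero, pow_zero]
    ring
  · have h1 : scrambleDigits π d i = 1 := by lia
    have hle : scrambleReal d' π ≤ scrambleReal d π :=
      ofDigits_le_ofDigits (fun k hk => (hcongr k hk).symm) hlt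
    rw [max_eq_left hle, h1, digitSign]
    simp only [Fin.val_one, pow_one]
    ring

lemma integrable_one_sub_max_scrambleReal (d d' : ℕ → Fin 2) :
    Integrable (fun π => 1 - max (scrambleReal d π) (scrambleReal d' π)) treeLaw :=
  (integrable_const 1).sub ((integrable_scrambleReal d).sup (integrable_scrambleReal d'))

lemma integral_one_sub_max_scrambleReal {d d' : ℕ → Fin 2} {i : ℕ} (h : ∀ k < i, d k = d' k)
    (hi : d i ≠ d' i) :
    ∫ π, (1 - max (scrambleReal d π) (scrambleReal d' π)) ∂treeLaw =
      1 / 2 - 1 / 4 * (1 / 2) ^ i := by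
  have hint := integrable_signSum
  have hint' := integrable_permSign_mul_signSum
  have hexpand (π : TreeScramble) : 1 - max (scrambleReal d π) (scrambleReal d' π) =
      1 / 2 + 1 / 4 * signSum d π + 1 / 4 * signSum d' π -
        (digitSign (d i) / 4 * (permSign (π (digitPrefix d i)) * signSum d π) -
          digitSign (d i) / 4 * (permSign (π (digitPrefix d' i)) * signSum d' π)) := by
    rw [max_scrambleReal h hi, scrambleReal_eq, scrambleReal_eq, scrambleDigits, digitSign_apply,
      ← digitPrefix_congr h]
    ring
  simp_rw [hexpand]
  rw [integral_sub (by fun_prop) (by fun_prop), integral_sub (by fun_prop) (by fun_prop),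
    integral_add (by fun_prop) (by fun_prop), integral_add (by fun_prop) (by fun_prop)]
  simp only [integral_const_mul, integral_signSum, integral_permSign_mul_signSum,
    digitSign_of_ne hi, integral_const, probReal_univ, smul_eq_mul]
  linear_combination (-(1 / 2 : ℝ) ^ (i + 1) / 2) * digitSign_mul_self (d i)

/-! ### Walsh series with coefficients `ψ` -/

/-- The Walsh function of index `k` as a function of the signs `c i` of the digits of its argument:
the product of the `c i` over the nonzero binary digits `i` of `k`. -/
def walsh {M : Type*} [CommMonoid M] (c : ℕ → M) (k : ℕ) : M :=
  ∏ i ∈ Finset.range k.size, if k.testBit i then c i else 1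

/-- The Walsh series with coefficients `ψ`. -/
noncomputable def walshSeries (c : ℕ → ℝ) : ℝ := ∑' k, psi k * walsh c k

lemma size_two_mul {k : ℕ} (h : k ≠ 0) : (2 * k).size = k.size + 1 := by
  simpa [Nat.bit] using Nat.size_bit (b := false) (n := k) (by simpa [Nat.bit] using h)

lemma size_two_mul_add_one (k : ℕ) : (2 * k + 1).size = k.size + 1 := by
  simpa [Nat.bit] using Nat.size_bit (b := true) (n := k) (by simp [Nat.bit])

section CommMonoid

variable {M : Type*} [CommMonoid M] (c c' : ℕ → M)

lemma walsh_eq_prod_range {k n : ℕ} (h : k.size ≤ n) :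
    walsh c k = ∏ i ∈ Finset.range n, if k.testBit i then c i else 1 := by
  refine Finset.prod_subset (Finset.range_mono h) fun i _ hi => ?_
  have hlt : k < 2 ^ i := Nat.size_le.1 (by simpa using hi)
  simp [Nat.testBit_lt_two_pow hlt]

lemma walsh_zero : walsh c 0 = 1 := by simp [walsh]

lemma walsh_two_mul (k : ℕ) : walsh c (2 * k) = walsh (fun i => c (i + 1)) k := by
  rcases eq_or_ne k 0 with rfl | hk
  · simp [walsh]
  · rw [walsh, size_two_mul hk, Finset.prod_range_succ']
    simp [walsh, Nat.testBit_succ]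

lemma walsh_two_mul_add_one (k : ℕ) :
    walsh c (2 * k + 1) = c 0 * walsh (fun i => c (i + 1)) k := by
  rw [walsh, size_two_mul_add_one, Finset.prod_range_succ', mul_comm]
  have h (i : ℕ) : (2 * k + 1).testBit (i + 1) = k.testBit i := by
    rw [Nat.testBit_succ]; congr 1; lia
  simp [walsh, h]

lemma walsh_mul (k : ℕ) : walsh (fun i => c i * c' i) k = walsh c k * walsh c' k := by
  rw [walsh, walsh, walsh, ← Finset.prod_mul_distrib]
  exact Finset.prod_congr rfl fun i _ => by split_ifs <;> simp

end CommMonoid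

lemma abs_walsh {c : ℕ → ℝ} (hc : ∀ i, |c i| = 1) (k : ℕ) : |walsh c k| = 1 := by
  rw [walsh, Finset.abs_prod]
  exact Finset.prod_eq_one fun i _ => by split_ifs <;> simp [hc]

lemma psi_zero : psi 0 = 1 := by simp [psi]

lemma psi_pos (k : ℕ) : 0 < psi k := by unfold psi; positivity

lemma psi_two_mul {k : ℕ} (h : k ≠ 0) : psi (2 * k) = 1 / 4 * psi k := by
  rw [psi, psi, size_two_mul h, pow_succ]; field_simp

lemma psi_two_mul_add_one (k : ℕ) : psi (2 * k + 1) = 1 / 4 * psi k := by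
  rw [psi, psi, size_two_mul_add_one, pow_succ]; field_simp

lemma psi_le_inv_sq {k : ℕ} (hk : 0 < k) : psi k ≤ ((k : ℝ) ^ 2)⁻¹ := by
  have hk' : (k : ℝ) ≤ 2 ^ k.size := by exact_mod_cast (Nat.lt_size_self k).le
  rw [psi, one_div]
  refine inv_anti₀ (by positivity) ?_
  calc (k : ℝ) ^ 2 ≤ (2 ^ k.size) ^ 2 := by gcongr
    _ = 4 ^ k.size := by rw [← pow_mul, mul_comm, pow_mul]; norm_num

lemma summable_psi_rpow {r : ℝ} (h : 1 / 2 < r) : Summable fun k => psi k ^ r := by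
  refine .of_norm_bounded_eventually_nat
    (Real.summable_nat_rpow_inv.2 (show 1 < 2 * r by linarith)) ?_
  filter_upwards [Filter.eventually_gt_atTop 0] with k hk
  calc ‖psi k ^ r‖ = psi k ^ r := Real.norm_of_nonneg (Real.rpow_nonneg (psi_pos k).le r)
    _ ≤ (((k : ℝ) ^ 2)⁻¹) ^ r :=
        Real.rpow_le_rpow (psi_pos k).le (psi_le_inv_sq hk) (by linarith)
    _ = ((k : ℝ) ^ (2 * r))⁻¹ := by
        rw [Real.inv_rpow (by positivity), Real.rpow_mul k.cast_nonneg, Real.rpow_two]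

lemma tsum_psi_rpow {r : ℝ} (h : 1 / 2 < r) :
    ∑' k, psi k ^ r = ((2 : ℝ) ^ (2 * r) - 1) / ((2 : ℝ) ^ (2 * r) - 2) := by
  have h4 : (2 : ℝ) ^ (2 * r) = 4 ^ r := by rw [Real.rpow_mul zero_le_two]; norm_num
  have h2 : (2 : ℝ) < 4 ^ r := by
    rw [← h4]
    exact Real.self_lt_rpow_of_one_lt one_lt_two (by linarith)
  have hquarter (k : ℕ) : (1 / 4 * psi k) ^ r = ((4 : ℝ) ^ r)⁻¹ * psi k ^ r := by
    rw [Real.mul_rpow (by norm_num) (psi_pos k).le, one_div, Real.inv_rpow (by norm_num)]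
  have hrec := tsum_of_binary_recursion (summable_psi_rpow h) (summable_psi_rpow h)
    (fun k hk => by rw [psi_two_mul hk, hquarter])
    (fun k => by rw [psi_two_mul_add_one, hquarter])
  rw [psi_zero, Real.one_rpow] at hrec
  rw [h4, eq_div_iff (by linarith)]
  have hne : (4 : ℝ) ^ r ≠ 0 := by linarith
  field_simp at hrec
  linarith

lemma summable_walshSeries {c : ℕ → ℝ} (hc : ∀ i, |c i| = 1) :
    Summable fun k => psi k * walsh c k := by
  have h := summable_psi_rpow (r := 1) (by norm_num)
  simp only [Real.rpow_one] at h
  refine Summable.of_norm_bounded h fun k => ?_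
  rw [norm_mul, Real.norm_eq_abs, Real.norm_eq_abs, abs_walsh hc, mul_one, abs_of_pos (psi_pos k)]

lemma walshSeries_eq {c : ℕ → ℝ} (hc : ∀ i, |c i| = 1) :
    walshSeries c = 3 / 4 + (1 + c 0) / 4 * walshSeries fun i => c (i + 1) := by
  have hrec := tsum_of_binary_recursion (a := 1 / 4) (b := c 0 / 4) (summable_walshSeries hc)
    (summable_walshSeries fun i => hc (i + 1))
    (fun k hk => by rw [psi_two_mul hk, walsh_two_mul, mul_assoc])
    (fun k => by rw [psi_two_mul_add_one, walsh_two_mul_add_one]; ring)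
  simp only [psi_zero, walsh_zero] at hrec
  rw [walshSeries, walshSeries, hrec]
  ring

lemma walshSeries_one : (walshSeries fun _ => 1) = 3 / 2 := by
  linarith [walshSeries_eq (c := fun _ => 1) (by simp)]

lemma walshSeries_of_first_neg_one {i : ℕ} {c : ℕ → ℝ} (hc : ∀ i, |c i| = 1)
    (h : ∀ k < i, c k = 1) (hi : c i = -1) : walshSeries c = 3 / 2 - 3 / 4 * (1 / 2) ^ i := by
  induction i generalizing c with
  | zero => rw [walshSeries_eq hc, hi]; norm_num
  | succ i ih =>
    rw [walshSeries_eq hc, h 0 (by lia),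
      ih (fun i => hc (i + 1)) (fun k hk => h (k + 1) (by lia)) hi]
    ring

lemma integral_one_sub_max_scrambleReal_eq_walshSeries (d d' : ℕ → Fin 2) :
    ∫ π, (1 - max (scrambleReal d π) (scrambleReal d' π)) ∂treeLaw =
      1 / 3 * walshSeries fun i => digitSign (d i) * digitSign (d' i) := by
  classical
  by_cases h : d = d'
  · subst h
    simp only [max_self, integral_one_sub_scrambleReal, digitSign_mul_self, walshSeries_one]
    norm_num
  · have hex : ∃ i, d i ≠ d' i := Function.ne_iff.1 h
    have hmin : ∀ k < Nat.find hex, d k = d' k := fun k hk => not_not.1 (Nat.find_min hex hk)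
    have hsign (i : ℕ) : |digitSign (d i) * digitSign (d' i)| = 1 := by
      rw [abs_mul, abs_digitSign, abs_digitSign, one_mul]
    have hfirst : ∀ k < Nat.find hex, digitSign (d k) * digitSign (d' k) = 1 := fun k hk => by
      rw [hmin k hk, digitSign_mul_self]
    have hneg : digitSign (d (Nat.find hex)) * digitSign (d' (Nat.find hex)) = -1 := by
      rw [digitSign_of_ne (Nat.find_spec hex), mul_neg, digitSign_mul_self]
    rw [integral_one_sub_max_scrambleReal hmin (Nat.find_spec hex),
      walshSeries_of_first_neg_one hsign hfirst hneg]
    ring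

/-! ### Warnock's formula -/

/-- The expression `N⁻² ∑ F n n' - 2 N⁻¹ ∑ G n + H` in which a squared discrepancy of `N` points
takes its values: `F` is the kernel at two points, `G` the kernel integrated once and `H` the kernel
integrated twice. -/
noncomputable def discrepancyForm {N : ℕ} (F : Fin N → Fin N → ℝ) (G : Fin N → ℝ) (H : ℝ) : ℝ :=
  (∑ n, ∑ n', F n n') / N ^ 2 - 2 / N * ∑ n, G n + H

lemma sq_sum_div_sub {N : ℕ} (a : Fin N → ℝ) (b : ℝ) :
    ((∑ n, a n) / N - b) ^ 2 =
      discrepancyForm (fun n n' => a n * a n') (fun n => a n * b) (b ^ 2) := by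
  rw [discrepancyForm, ← Finset.sum_mul_sum, ← Finset.sum_mul]
  ring

section Integral

variable {α : Type*} [MeasurableSpace α] {μ : Measure α} {N : ℕ} {F : α → Fin N → Fin N → ℝ}
  {G : α → Fin N → ℝ} {H : α → ℝ}

lemma integrable_discrepancyForm (hF : ∀ n n', Integrable (fun a => F a n n') μ)
    (hG : ∀ n, Integrable (fun a => G a n) μ) (hH : Integrable H μ) :
    Integrable (fun a => discrepancyForm (F a) (G a) (H a)) μ :=
  (((integrable_finsetSum _ fun n _ => integrable_finsetSum _ fun n' _ => hF n n').div_const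
    _).sub ((integrable_finsetSum _ fun n _ => hG n).const_mul _)).add hH

lemma integral_discrepancyForm (hF : ∀ n n', Integrable (fun a => F a n n') μ)
    (hG : ∀ n, Integrable (fun a => G a n) μ) (hH : Integrable H μ) :
    ∫ a, discrepancyForm (F a) (G a) (H a) ∂μ =
      discrepancyForm (fun n n' => ∫ a, F a n n' ∂μ) (fun n => ∫ a, G a n ∂μ) (∫ a, H a ∂μ) := by
  have hFsum (n : Fin N) : Integrable (fun a => ∑ n', F a n n') μ :=
    integrable_finsetSum _ fun n' _ => hF n n'
  have hF' := (integrable_finsetSum Finset.univ fun n _ => hFsum n).div_const ((N : ℝ) ^ 2)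
  have hG' := (integrable_finsetSum Finset.univ fun n _ => hG n).const_mul (2 / (N : ℝ))
  simp only [discrepancyForm]
  rw [integral_add (by exact hF'.sub hG') hH, integral_sub hF' hG', integral_div,
    integral_const_mul, integral_finsetSum _ fun n _ => hG n,
    integral_finsetSum _ fun n _ => hFsum n]
  simp only [integral_finsetSum _ fun n' _ => hF _ n']

end Integral

section UnitCube

variable {ι : Type*} [Fintype ι]

lemma restrict_Icc_eq_pi : volume.restrict (Set.Icc (0 : ι → ℝ) 1) =
    Measure.pi fun _ : ι => volume.restrict (Set.Icc (0 : ℝ) 1) := by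
  rw [← Set.pi_univ_Icc, volume_pi, Measure.restrict_pi_pi]
  rfl

lemma integrableOn_Icc_prod {f : ι → ℝ → ℝ} (hf : ∀ j, IntegrableOn (f j) (Set.Icc 0 1)) :
    IntegrableOn (fun t : ι → ℝ => ∏ j, f j (t j)) (Set.Icc 0 1) := by
  rw [IntegrableOn, restrict_Icc_eq_pi]
  exact Integrable.fintype_prod hf

lemma setIntegral_Icc_prod (f : ι → ℝ → ℝ) :
    ∫ t in Set.Icc (0 : ι → ℝ) 1, ∏ j, f j (t j) = ∏ j, ∫ t in Set.Icc 0 1, f j t := by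
  rw [restrict_Icc_eq_pi, integral_fintype_prod_eq_prod]

end UnitCube

lemma setIntegral_Icc_indicator_Ioi {a : ℝ} (ha : a ∈ Set.Icc 0 1) (g : ℝ → ℝ) :
    ∫ t in Set.Icc 0 1, (Set.Ioi a).indicator g t = ∫ t in a..1, g t := by
  rw [setIntegral_indicator measurableSet_Ioi, intervalIntegral.integral_of_le ha.2]
  congr 2
  ext t
  exact ⟨fun h => ⟨h.2, h.1.2⟩, fun h => ⟨⟨ha.1.trans h.1.le, h.2⟩, h.1⟩⟩

lemma localDiscrepancy_extendByOne {N s : ℕ} {y : Fin N → Fin s → ℝ}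
    (hy : ∀ n j, y n j ∈ Set.Ico 0 1) (u : Finset (Fin s)) (t : u → ℝ) :
    localDiscrepancy y (extendByOne u t) =
      (∑ n, ∏ j : u, (Set.Ioi (y n j)).indicator 1 (t j)) / N - ∏ j, t j := by
  classical
  have hmem (n : Fin N) : (∀ j, y n j ∈ Set.Ico 0 (extendByOne u t j)) ↔ ∀ j : u, y n j < t j := by
    refine ⟨fun h j => by simpa [extendByOne] using (h j).2, fun h j => ⟨(hy n j).1, ?_⟩⟩
    unfold extendByOne
    split_ifs with hj
    · exact h ⟨j, hj⟩
    · exact (hy n j).2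
  have hprod : ∏ j, extendByOne u t j = ∏ j, t j := by
    rw [← Finset.prod_subset (Finset.subset_univ u) fun j _ hj => by simp [extendByOne, hj],
      ← Finset.prod_coe_sort]
    exact Finset.prod_congr rfl fun j _ => by simp [extendByOne]
  rw [localDiscrepancy, hprod]
  simp only [hmem, Nat.card_eq_fintype_card, Fintype.card_subtype, Finset.natCast_card_filter,
    Set.indicator_apply, Set.mem_Ioi, Pi.one_apply, Finset.prod_boole, Finset.mem_univ,
    forall_true_left]

/-- The squared `L₂` norm of the local discrepancy over the face belonging to `u`, in Warnock's
closed form. -/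
noncomputable def faceDiscrepancy {N s : ℕ} (u : Finset (Fin s)) (y : Fin N → Fin s → ℝ) : ℝ :=
  discrepancyForm (fun n n' => ∏ j ∈ u, (1 - max (y n j) (y n' j)))
    (fun n => ∏ j ∈ u, (1 - y n j ^ 2) / 2) (1 / 3 ^ u.card)

lemma localDiscrepancy_extendByOne_sq {N s : ℕ} {y : Fin N → Fin s → ℝ}
    (hy : ∀ n j, y n j ∈ Set.Ico 0 1) (u : Finset (Fin s)) (t : u → ℝ) :
    |localDiscrepancy y (extendByOne u t)| ^ 2 =
      discrepancyForm (fun n n' => ∏ j : u, (Set.Ioi (max (y n j) (y n' j))).indicator 1 (t j))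
        (fun n => ∏ j : u, (Set.Ioi (y n j)).indicator id (t j)) (∏ j, t j ^ 2) := by
  rw [sq_abs, localDiscrepancy_extendByOne hy, sq_sum_div_sub]
  simp only [← Finset.prod_mul_distrib, ← Finset.prod_pow, ← Set.Ioi_inter_Ioi,
    Set.indicator_apply, Set.mem_inter_iff, ite_and, Pi.one_apply, id, ite_mul, one_mul, zero_mul]

theorem setIntegral_localDiscrepancy_sq {N s : ℕ} {y : Fin N → Fin s → ℝ}
    (hy : ∀ n j, y n j ∈ Set.Ico 0 1) (u : Finset (Fin s)) :
    ∫ t in Set.Icc (0 : u → ℝ) 1, |localDiscrepancy y (extendByOne u t)| ^ 2 =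
      faceDiscrepancy u y := by
  have hmax (n n' : Fin N) (j : Fin s) : max (y n j) (y n' j) ∈ Set.Icc 0 1 :=
    ⟨le_max_of_le_left (hy n j).1, max_le (hy n j).2.le (hy n' j).2.le⟩
  have hint (a : ℝ) {g : ℝ → ℝ} (hg : Continuous g) :
      IntegrableOn ((Set.Ioi a).indicator g) (Set.Icc 0 1) :=
    hg.integrableOn_Icc.integrable.indicator measurableSet_Ioi
  have hsq : ∫ t in Set.Icc (0 : ℝ) 1, t ^ 2 = 1 / 3 := by
    rw [integral_Icc_eq_integral_Ioc, ← intervalIntegral.integral_of_le zero_le_one, integral_pow]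
    norm_num
  simp only [localDiscrepancy_extendByOne_sq hy]
  rw [integral_discrepancyForm
    (fun n n' => integrableOn_Icc_prod fun j => hint _ continuous_one)
    (fun n => integrableOn_Icc_prod fun j => hint _ continuous_id)
    (integrableOn_Icc_prod fun j => (continuous_pow 2).integrableOn_Icc),
    setIntegral_Icc_prod fun (_ : u) t => t ^ 2]
  simp only [setIntegral_Icc_prod, setIntegral_Icc_indicator_Ioi (hmax _ _ _),
    setIntegral_Icc_indicator_Ioi (Set.Ico_subset_Icc_self (hy _ _)), hsq, Pi.one_apply, id,
    integral_id, intervalIntegral.integral_const, one_pow, smul_eq_mul, mul_one,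
    Finset.prod_const, Finset.card_univ, Fintype.card_coe, faceDiscrepancy, div_pow,
    ← Finset.prod_coe_sort u]

/-! ### The expectation over all scrambles -/

/-- The scramble of the `j`-th coordinate. -/
def Scramble.tree {s : ℕ} (π : Scramble s) (j : Fin s) : TreeScramble := fun l => π (j, l)

instance (s : ℕ) : IsProbabilityMeasure (scrambleLaw s) := by
  unfold scrambleLaw; infer_instance

lemma measurePreserving_tree (s : ℕ) :
    MeasurePreserving (fun (π : Scramble s) j => π.tree j) (scrambleLaw s)
      (Measure.pi fun _ => treeLaw) := by
  refine ⟨measurable_pi_lambda _ fun j => measurable_pi_lambda _ fun l => measurable_pi_apply _, ?_⟩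
  rw [← Measure.infinitePi_eq_pi]
  exact Measure.infinitePi_map_curry fun (_ : Fin s) (_ : List (Fin 2)) => permLaw

section ProdTree

variable {s : ℕ} (u : Finset (Fin s)) {g : Fin s → TreeScramble → ℝ}

lemma integrable_prod_tree (hg : ∀ j, Integrable (g j) treeLaw) :
    Integrable (fun π : Scramble s => ∏ j ∈ u, g j (π.tree j)) (scrambleLaw s) := by
  have h : Integrable (fun τ : Fin s → TreeScramble => ∏ j, (if j ∈ u then g j else 1) (τ j))
      (Measure.pi fun _ => treeLaw) :=
    Integrable.fintype_prod fun j => by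
      split_ifs
      · exact hg j
      · exact integrable_const 1
  simpa only [Function.comp_def, ite_apply, Pi.one_apply, Fintype.prod_ite_mem] using
    (measurePreserving_tree s).integrable_comp_of_integrable h

lemma integral_prod_tree (hg : ∀ j, AEStronglyMeasurable (g j) treeLaw) :
    ∫ π : Scramble s, ∏ j ∈ u, g j (π.tree j) ∂(scrambleLaw s) =
      ∏ j ∈ u, ∫ τ, g j τ ∂treeLaw := by
  have hmeas : AEStronglyMeasurable (fun τ : Fin s → TreeScramble => ∏ j ∈ u, g j (τ j))
      ((scrambleLaw s).map fun π j => π.tree j) := by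
    rw [(measurePreserving_tree s).map_eq]
    exact Finset.aestronglyMeasurable_fun_prod _ fun j _ =>
      (hg j).comp_measurePreserving (measurePreserving_eval (fun _ => treeLaw) j)
  have hmap := integral_map (measurePreserving_tree s).measurable.aemeasurable hmeas
  have hprod := integral_fintype_prod_eq_prod (μ := fun _ : Fin s => treeLaw)
    fun j => if j ∈ u then g j else 1
  rw [← hmap, (measurePreserving_tree s).map_eq]
  have hfactor (j : Fin s) : ∫ τ, (if j ∈ u then g j else 1) τ ∂treeLaw =
      if j ∈ u then ∫ τ, g j τ ∂treeLaw else 1 := by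
    split_ifs <;> simp
  rw [Finset.prod_congr rfl fun j _ => hfactor j] at hprod
  simpa only [ite_apply, Pi.one_apply, Fintype.prod_ite_mem] using hprod

end ProdTree

lemma ae_scramblePoint_mem {N s : ℕ} (x : Fin N → Fin s → ℝ) :
    ∀ᵐ π ∂scrambleLaw s, ∀ n j, scramblePoint π (x n) j ∈ Set.Ico 0 1 := by
  refine ae_all_iff.2 fun n => ae_all_iff.2 fun j => ?_
  have h := (measurePreserving_eval (fun _ : Fin s => treeLaw) j).comp (measurePreserving_tree s)
  filter_upwards [h.quasiMeasurePreserving.ae (ae_scrambleReal_lt_one (Real.digits (x n j) 2))]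
    with π hπ
  exact ⟨scrambleReal_nonneg (Real.digits (x n j) 2) (π.tree j), hπ⟩

lemma weightedL2_sq {N s : ℕ} {γ : Finset (Fin s) → ℝ} (hγ : ∀ u, 0 ≤ γ u)
    {y : Fin N → Fin s → ℝ} (hy : ∀ n j, y n j ∈ Set.Ico 0 1) :
    weightedL2 γ y ^ 2 = ∑ u : Finset (Fin s) with u.Nonempty, γ u * faceDiscrepancy u y := by
  simp only [← setIntegral_localDiscrepancy_sq hy]
  exact Real.sq_sqrt <| Finset.sum_nonneg fun u _ =>
    mul_nonneg (hγ u) (integral_nonneg fun _ => by positivity)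

section MeanSquare

variable {N s : ℕ} (x : Fin N → Fin s → ℝ)

lemma integrable_faceDiscrepancy (u : Finset (Fin s)) :
    Integrable (fun π => faceDiscrepancy u fun n => scramblePoint π (x n)) (scrambleLaw s) :=
  integrable_discrepancyForm
    (fun _ _ => integrable_prod_tree u fun _ => integrable_one_sub_max_scrambleReal _ _)
    (fun _ => integrable_prod_tree u fun _ => integrable_one_sub_scrambleReal_sq _)
    (integrable_const _)

lemma integral_faceDiscrepancy (hN : N ≠ 0) (u : Finset (Fin s)) :
    ∫ π, faceDiscrepancy u (fun n => scramblePoint π (x n)) ∂(scrambleLaw s) =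
      1 / 3 ^ u.card * ((∑ n, ∑ n', ∏ j ∈ u, walshSeries fun i =>
        digitSign (Real.digits (x n j) 2 i) * digitSign (Real.digits (x n' j) 2 i)) / N ^ 2 -
          1) := by
  have hN' : (N : ℝ) ≠ 0 := Nat.cast_ne_zero.2 hN
  have hF (n n' : Fin N) := integral_prod_tree u fun j =>
    (integrable_one_sub_max_scrambleReal (Real.digits (x n j) 2)
      (Real.digits (x n' j) 2)).aestronglyMeasurable
  have hG (n : Fin N) := integral_prod_tree u fun j =>
    (integrable_one_sub_scrambleReal_sq (Real.digits (x n j) 2)).aestronglyMeasurable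
  simp only [integral_one_sub_max_scrambleReal_eq_walshSeries, integral_one_sub_scrambleReal_sq,
    Finset.prod_mul_distrib, Finset.prod_const] at hF hG
  refine (integral_discrepancyForm
    (fun _ _ => integrable_prod_tree u fun _ => integrable_one_sub_max_scrambleReal _ _)
    (fun _ => integrable_prod_tree u fun _ => integrable_one_sub_scrambleReal_sq _)
    (integrable_const _)).trans ?_
  simp only [hF, hG, discrepancyForm, ← Finset.mul_sum, integral_const,
    probReal_univ, Finset.sum_const, Finset.card_univ, Fintype.card_fin, nsmul_eq_mul, smul_eq_mul,
    div_pow, one_pow]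
  field_simp
  ring

lemma meanSquareL2_eq (hN : N ≠ 0) {γ : Finset (Fin s) → ℝ} (hγ : ∀ u, 0 ≤ γ u) :
    meanSquareL2 γ x = ∑ u : Finset (Fin s) with u.Nonempty,
      γ u / 3 ^ u.card * ((∑ n, ∑ n', ∏ j ∈ u, walshSeries fun i =>
        digitSign (Real.digits (x n j) 2 i) * digitSign (Real.digits (x n' j) 2 i)) / N ^ 2 -
          1) := by
  have hae : ∀ᵐ π ∂scrambleLaw s, weightedL2 γ (fun n => scramblePoint π (x n)) ^ 2 =
      ∑ u : Finset (Fin s) with u.Nonempty,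
        γ u * faceDiscrepancy u (fun n => scramblePoint π (x n)) := by
    filter_upwards [ae_scramblePoint_mem x] with π hπ using weightedL2_sq hγ hπ
  rw [meanSquareL2, integral_congr_ae hae,
    integral_finsetSum _ fun u _ => (integrable_faceDiscrepancy x u).const_mul _]
  simp only [integral_const_mul, integral_faceDiscrepancy x hN, ← mul_assoc, mul_one_div]

end MeanSquare

lemma initialMeanSquareL2_eq {s : ℕ} {γ : Finset (Fin s) → ℝ} (hγ : ∀ u, 0 ≤ γ u) :
    initialMeanSquareL2 γ = ∑ u : Finset (Fin s) with u.Nonempty, γ u / 3 ^ u.card := by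
  have h (y : Fin 0 → Fin s → ℝ) : weightedL2 γ y ^ 2 =
      ∑ u : Finset (Fin s) with u.Nonempty, γ u / 3 ^ u.card := by
    simp [weightedL2_sq hγ fun n => n.elim0, faceDiscrepancy, discrepancyForm, div_eq_mul_inv]
  simp only [initialMeanSquareL2, meanSquareL2, h, integral_const, probReal_univ, one_smul]

open scoped Polynomial
open Polynomial (X degreeLT)

/-! ### Polynomials over `𝔽₂` and binary expansions -/

lemma coeff_truncPoly (m k i : ℕ) :
    (truncPoly m k).coeff i = if i < m ∧ k.testBit i then 1 else 0 := by
  have hcoeff (l : ℕ) : (if k.testBit l then (X : (ZMod 2)[X]) ^ l else 0).coeff i =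
      if i = l then (if k.testBit i then 1 else 0) else 0 := by
    by_cases h : i = l <;> by_cases hl : k.testBit l <;> simp [hl, h, Polynomial.coeff_X_pow]
  simp only [truncPoly, Polynomial.finsetSum_coeff, hcoeff, Finset.sum_ite_eq, Finset.mem_range,
    ite_and]

lemma degree_truncPoly_lt (m k : ℕ) : (truncPoly m k).degree < m :=
  (Polynomial.degree_lt_iff_coeff_zero _ _).2 fun i hi => by
    rw [coeff_truncPoly, if_neg fun h => h.1.not_ge hi]

lemma truncPoly_zero (m : ℕ) : truncPoly m 0 = 0 := by simp [truncPoly]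

lemma natPoly_eq_truncPoly {m n : ℕ} (h : n < 2 ^ m) : natPoly n = truncPoly m n := by
  ext i
  have hsize : n.testBit i → i < n.size := fun hi => Nat.lt_size.2 (Nat.ge_two_pow_of_testBit hi)
  have hm : n.testBit i → i < m := fun hi => (hsize hi).trans_le (Nat.size_le.2 h)
  simp only [natPoly, coeff_truncPoly, and_iff_right_of_imp hsize, and_iff_right_of_imp hm]

lemma bijOn_truncPoly (m : ℕ) :
    Set.BijOn (truncPoly m) (Set.Iio (2 ^ m)) {f | f.degree < m} := by
  refine ⟨fun k _ => degree_truncPoly_lt m k, fun k hk l hl h => ?_, fun f hf => ?_⟩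
  · refine Nat.eq_of_testBit_eq fun i => ?_
    by_cases hi : i < m
    · have hcoeff := congrArg (Polynomial.coeff · i) h
      simp only [coeff_truncPoly, hi, true_and] at hcoeff
      cases hki : k.testBit i <;> cases hli : l.testBit i <;> simp_all
    · have hpow : 2 ^ m ≤ 2 ^ i := Nat.pow_le_pow_right two_pos (not_lt.1 hi)
      rw [Nat.testBit_lt_two_pow (lt_of_lt_of_le hk hpow),
        Nat.testBit_lt_two_pow (lt_of_lt_of_le hl hpow)]
  · refine ⟨Nat.ofBits fun i : Fin m => decide (f.coeff i = 1), Nat.ofBits_lt_two_pow _, ?_⟩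
    ext i
    rw [coeff_truncPoly]
    by_cases hi : i < m
    · have hbit : ∀ a : ZMod 2, (if a = 1 then 1 else 0) = a := by decide
      simpa [hi, Nat.testBit_ofBits_lt] using hbit (f.coeff i)
    · rw [if_neg fun h => hi h.1,
        (Polynomial.degree_lt_iff_coeff_zero f m).1 hf i (not_lt.1 hi)]

lemma truncPoly_mod_two_pow (m k : ℕ) : truncPoly m (k % 2 ^ m) = truncPoly m k := by
  ext i
  by_cases hi : i < m <;> simp [coeff_truncPoly, Nat.testBit_mod_two_pow, hi]

lemma truncPoly_eq_zero_iff {m k : ℕ} : truncPoly m k = 0 ↔ 2 ^ m ∣ k := by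
  rw [Nat.dvd_iff_mod_eq_zero, ← truncPoly_mod_two_pow]
  refine ⟨fun h => ?_, fun h => by rw [h, truncPoly_zero]⟩
  exact (bijOn_truncPoly m).injOn (Nat.mod_lt k (by positivity)) (Nat.two_pow_pos m)
    (h.trans (truncPoly_zero m).symm)

/-- The enumeration of the polynomials of degree less than `m` by `n < 2 ^ m`. -/
noncomputable def truncPolyEquiv (m : ℕ) : Fin (2 ^ m) ≃ degreeLT (ZMod 2) m :=
  Equiv.ofBijective (fun n => ⟨truncPoly m n, Polynomial.mem_degreeLT.2 (degree_truncPoly_lt m n)⟩)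
    ⟨fun a b h => Fin.ext ((bijOn_truncPoly m).injOn a.2 b.2 (congrArg Subtype.val h)),
      fun f => by
        obtain ⟨n, hn, hf⟩ := (bijOn_truncPoly m).surjOn (Polynomial.mem_degreeLT.1 f.2)
        exact ⟨⟨n, hn⟩, Subtype.ext hf⟩⟩

noncomputable instance (m : ℕ) : Fintype (degreeLT (ZMod 2) m) :=
  Fintype.ofEquiv _ (truncPolyEquiv m)

lemma card_degreeLT (m : ℕ) : Fintype.card (degreeLT (ZMod 2) m) = 2 ^ m := by
  rw [← Fintype.card_congr (truncPolyEquiv m), Fintype.card_fin]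

/-! ### Residues of rational functions -/

lemma coeff_toLaurent (f : (ZMod 2)[X]) (l : ℤ) :
    (toLaurent f).coeff l = if l ≤ 0 then f.coeff l.natAbs else 0 := by
  have h : toLaurent f = ∑ i ∈ Finset.range (f.natDegree + 1),
      HahnSeries.single (-(i : ℤ)) (f.coeff i) := by
    rw [toLaurent, Polynomial.aeval_def, Polynomial.eval₂_eq_sum_range, Subsingleton.elim
      (algebraMap (ZMod 2) (LaurentSeries (ZMod 2))) HahnSeries.C]
    simp [HahnSeries.single_pow, HahnSeries.C_apply, HahnSeries.single_mul_single]
  simp only [h, HahnSeries.coeff_sum, HahnSeries.coeff_single]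
  split_ifs with hl
  · have hcond (i : ℕ) : l = -(i : ℤ) ↔ l.natAbs = i := by lia
    simp only [hcond, Finset.sum_ite_eq, Finset.mem_range, Nat.lt_succ_iff, ite_eq_left_iff,
      not_le]
    exact fun hd => (Polynomial.coeff_eq_zero_of_natDegree_lt hd).symm
  · exact Finset.sum_eq_zero fun i _ => if_neg (by lia)

lemma toLaurent_X_pow (i : ℕ) :
    toLaurent (X ^ i) = HahnSeries.single (-(i : ℤ)) (1 : ZMod 2) := by
  simp [toLaurent, HahnSeries.single_pow]

lemma toLaurent_ne_zero {p : (ZMod 2)[X]} (hp : p ≠ 0) : toLaurent p ≠ 0 := by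
  contrapose! hp
  ext i
  simpa [coeff_toLaurent] using congrArg (fun f => f.coeff (-(i : ℤ))) hp

/-- The coefficient of `x⁻¹` in the Laurent expansion of `f / p`, as a function of `f`. -/
noncomputable def residue (p : (ZMod 2)[X]) : (ZMod 2)[X] →+ ZMod 2 where
  toFun f := (toLaurent f / toLaurent p).coeff 1
  map_zero' := by simp [toLaurent]
  map_add' f g := by simp [toLaurent, add_div]

lemma residue_eq_zero_of_dvd {p f : (ZMod 2)[X]} (hp : p ≠ 0) (h : p ∣ f) : residue p f = 0 := by
  obtain ⟨g, rfl⟩ := h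
  have hdiv : toLaurent (p * g) / toLaurent p = toLaurent g := by
    rw [toLaurent, map_mul]
    exact mul_div_cancel_left₀ _ (toLaurent_ne_zero hp)
  change (toLaurent (p * g) / toLaurent p).coeff 1 = 0
  rw [hdiv, coeff_toLaurent, if_neg (by norm_num)]

lemma residue_X_pow_mul (p f : (ZMod 2)[X]) (i : ℕ) :
    residue p (X ^ i * f) = (toLaurent f / toLaurent p).coeff (i + 1 : ℤ) := by
  have hmul : toLaurent (X ^ i * f) / toLaurent p =
      HahnSeries.single (-(i : ℤ)) 1 * (toLaurent f / toLaurent p) := by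
    rw [← toLaurent_X_pow, toLaurent, map_mul, mul_div_assoc]
    rfl
  have hshift := HahnSeries.coeff_single_mul_add (r := (1 : ZMod 2))
    (x := toLaurent f / toLaurent p) (a := (i + 1 : ℤ)) (b := -(i : ℤ))
  rw [← hmul, one_mul, add_neg_cancel_comm] at hshift
  exact hshift

lemma exists_residue_X_pow_ne_zero {p : (ZMod 2)[X]} (hp : 0 < p.natDegree) :
    ∃ i : ℕ, residue p (X ^ i) ≠ 0 := by
  have hp0 : p ≠ 0 := Polynomial.ne_zero_of_natDegree_gt hp
  have hL := toLaurent_ne_zero hp0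
  have horder : (toLaurent p).order ≤ -(p.natDegree : ℤ) := by
    refine HahnSeries.order_le_of_coeff_ne_zero ?_
    rw [coeff_toLaurent, if_pos (by lia)]
    simpa using hp0
  have hsum : (toLaurent p).order + (toLaurent p)⁻¹.order = 0 := by
    rw [← HahnSeries.order_mul hL (inv_ne_zero hL), mul_inv_cancel₀ hL, HahnSeries.order_one]
  refine ⟨((toLaurent p)⁻¹.order - 1).toNat, ?_⟩
  have hone : toLaurent 1 = 1 := map_one (Polynomial.aeval _)
  have hres := residue_X_pow_mul p 1 ((toLaurent p)⁻¹.order - 1).toNat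
  rw [mul_one, hone, one_div, Int.toNat_of_nonneg (by lia), sub_add_cancel] at hres
  rw [hres]
  exact HahnSeries.coeff_order_eq_zero.not.2 (inv_ne_zero hL)

lemma exists_residue_mul_ne_zero {p h : (ZMod 2)[X]} (hp : Irreducible p) (hh : ¬p ∣ h) :
    ∃ f : (ZMod 2)[X], f.degree < p.natDegree ∧ residue p (f * h) ≠ 0 := by
  obtain ⟨i, hi⟩ := exists_residue_X_pow_ne_zero hp.natDegree_pos
  obtain ⟨a, b, hab⟩ := hp.coprime_iff_not_dvd.2 hh
  refine ⟨X ^ i * b % p, ?_, ?_⟩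
  · rw [← Polynomial.degree_eq_natDegree hp.ne_zero]
    exact EuclideanDomain.mod_lt _ hp.ne_zero
  have hX : X ^ i = p * (X ^ i * a + X ^ i * b / p * h) + X ^ i * b % p * h := by
    linear_combination (-X ^ i) * hab - h * EuclideanDomain.div_add_mod (X ^ i * b) p
  rwa [hX, map_add, residue_eq_zero_of_dvd hp.ne_zero (dvd_mul_right p _), zero_add] at hi

/-- The nontrivial character of `𝔽₂`. -/
noncomputable def chi : AddChar (ZMod 2) ℝ := AddChar.zmodChar 2 (ζ := -1) (by norm_num)

lemma chi_ne_one {a : ZMod 2} (ha : a ≠ 0) : chi a ≠ 1 := by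
  have ha' : a = 1 := by revert a; decide
  rw [ha', chi, AddChar.zmodChar_apply]
  norm_num [ZMod.val_one]

lemma abs_chi (a : ZMod 2) : |chi a| = 1 := by
  rw [chi, AddChar.zmodChar_apply, abs_neg_one_pow]

/-- The character `f ↦ chi (residue p (f * h))` of the polynomials of degree less than `m`. -/
noncomputable def residueChar (m : ℕ) (p h : (ZMod 2)[X]) : AddChar (degreeLT (ZMod 2) m) ℝ :=
  chi.compAddMonoidHom <| (residue p).comp <| (AddMonoidHom.mulRight h).comp
    (degreeLT (ZMod 2) m).subtype.toAddMonoidHom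

lemma residueChar_apply (m : ℕ) (p h : (ZMod 2)[X]) (f : degreeLT (ZMod 2) m) :
    residueChar m p h f = chi (residue p (f * h)) := rfl

lemma residueChar_eq_zero_iff {p h : (ZMod 2)[X]} (hp : Irreducible p) :
    residueChar p.natDegree p h = 0 ↔ p ∣ h := by
  simp only [AddChar.eq_zero_iff, residueChar_apply]
  refine ⟨fun hz => ?_, fun hd f => ?_⟩
  · by_contra hd
    obtain ⟨f, hf, hres⟩ := exists_residue_mul_ne_zero hp hd
    exact chi_ne_one hres (hz ⟨f, Polynomial.mem_degreeLT.2 hf⟩)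
  · rw [residue_eq_zero_of_dvd hp.ne_zero (hd.mul_left _), AddChar.map_zero_eq_one]

lemma sum_chi_residue {p : (ZMod 2)[X]} (hp : Irreducible p) (h : (ZMod 2)[X])
    [Decidable (p ∣ h)] :
    ∑ n : Fin (2 ^ p.natDegree), chi (residue p (truncPoly p.natDegree n * h)) =
      if p ∣ h then 2 ^ p.natDegree else 0 := by
  classical
  refine ((truncPolyEquiv p.natDegree).sum_comp (residueChar p.natDegree p h)).trans ?_
  simp only [AddChar.sum_eq_ite, residueChar_eq_zero_iff hp, card_degreeLT, Nat.cast_pow,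
    Nat.cast_ofNat]

/-! ### The mean square discrepancy as a sum over the dual lattice -/

/-- An element of `𝔽₂` as a dyadic digit. -/
def toDigit (a : ZMod 2) : Fin 2 := ⟨a.val, ZMod.val_lt a⟩

lemma digitSign_toDigit (a : ZMod 2) : digitSign (toDigit a) = chi a := rfl

lemma vMap_eq_ofDigits (m : ℕ) (L : LaurentSeries (ZMod 2)) :
    vMap m L = Real.ofDigits fun i : ℕ => if i < m then toDigit (L.coeff (i + 1 : ℤ)) else 0 := by
  have hterm (i : ℕ) (hi : i ∉ Finset.range m) : Real.ofDigitsTerm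
      (fun i : ℕ => if i < m then toDigit (L.coeff (i + 1 : ℤ)) else 0) i = 0 := by
    simp [Real.ofDigitsTerm, Finset.mem_range.not.1 hi]
  rw [vMap, Real.ofDigits, tsum_eq_sum hterm, ← Finset.Ico_add_one_right_eq_Icc,
    Finset.sum_Ico_eq_sum_range, Nat.add_sub_cancel]
  refine Finset.sum_congr rfl fun i hi => ?_
  simp only [Real.ofDigitsTerm, Finset.mem_range.1 hi, if_true, toDigit, add_comm 1 i,
    div_eq_mul_inv, Nat.cast_add, Nat.cast_one, Nat.cast_ofNat]

lemma digits_vMap (m : ℕ) (L : LaurentSeries (ZMod 2)) :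
    Real.digits (vMap m L) 2 =
      fun i : ℕ => if i < m then toDigit (L.coeff (i + 1 : ℤ)) else 0 := by
  rw [vMap_eq_ofDigits]
  exact digits_ofDigits fun n => ⟨m, by simp⟩

lemma digitSign_digits_latticePoint {s m : ℕ} (p : (ZMod 2)[X]) (q : Fin s → (ZMod 2)[X])
    (n : Fin (2 ^ m)) (j : Fin s) (i : ℕ) :
    digitSign (Real.digits (latticePoint m p q n j) 2 i) =
      if i < m then chi (residue p (X ^ i * (truncPoly m n * q j))) else 1 := by
  have hmul : toLaurent (truncPoly m n * q j) = toLaurent (truncPoly m n) * toLaurent (q j) :=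
    map_mul (Polynomial.aeval _) _ _
  simp only [latticePoint, digits_vMap, natPoly_eq_truncPoly n.2, residue_X_pow_mul, hmul]
  split_ifs
  · rw [digitSign_toDigit]
  · simp [digitSign]

lemma map_sum_eq_prod {ι A M : Type*} [AddCommMonoid A] [CommMonoid M] (χ : AddChar A M)
    (t : Finset ι) (f : ι → A) : χ (∑ i ∈ t, f i) = ∏ i ∈ t, χ (f i) :=
  map_prod χ.toMonoidHom (fun i => Multiplicative.ofAdd (f i)) t

lemma walsh_residue (m : ℕ) (p f : (ZMod 2)[X]) (k : ℕ) :
    walsh (fun i => if i < m then chi (residue p (X ^ i * f)) else 1) k =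
      chi (residue p (truncPoly m k * f)) := by
  rw [walsh_eq_prod_range _ (le_max_left k.size m), truncPoly, Finset.sum_mul, map_sum,
    map_sum_eq_prod, ← Finset.prod_subset (Finset.range_mono (le_max_right k.size m))]
  · refine Finset.prod_congr rfl fun i hi => ?_
    by_cases hk : k.testBit i <;> simp [hk, Finset.mem_range.1 hi]
  · intro i _ hi
    simp [Finset.mem_range.not.1 hi]

lemma walshSeries_latticePoint {s m : ℕ} (p : (ZMod 2)[X]) (q : Fin s → (ZMod 2)[X])
    (n n' : Fin (2 ^ m)) (j : Fin s) :
    (walshSeries fun i => digitSign (Real.digits (latticePoint m p q n j) 2 i) *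
      digitSign (Real.digits (latticePoint m p q n' j) 2 i)) =
    ∑' k, psi k * chi (residue p (truncPoly m k * ((truncPoly m n + truncPoly m n') * q j))) := by
  refine tsum_congr fun k => ?_
  simp only [digitSign_digits_latticePoint]
  rw [walsh_mul, walsh_residue, walsh_residue, ← AddChar.map_add_eq_mul, ← map_add, ← mul_add,
    ← add_mul]

lemma prod_psi_mul_chi {s : ℕ} (m : ℕ) (p f : (ZMod 2)[X]) (q : Fin s → (ZMod 2)[X])
    (k : Fin s → ℕ) :
    ∏ j, psi (k j) * chi (residue p (truncPoly m (k j) * (f * q j))) =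
      (∏ j, psi (k j)) * chi (residue p (f * ∑ j, truncPoly m (k j) * q j)) := by
  simp only [Finset.prod_mul_distrib, Finset.mul_sum, map_sum, map_sum_eq_prod,
    mul_left_comm f]

/-- The set of nonzero components. -/
def supp {s : ℕ} (k : Fin s → ℕ) : Finset (Fin s) := {j | k j ≠ 0}

lemma mem_supp {s : ℕ} {k : Fin s → ℕ} {j : Fin s} : j ∈ supp k ↔ k j ≠ 0 := by simp [supp]

lemma supp_eq_iff {s : ℕ} {k : Fin s → ℕ} {v : Finset (Fin s)} :
    supp k = v ↔ ∀ j, k j ≠ 0 ↔ j ∈ v := by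
  simp only [Finset.ext_iff, mem_supp]

lemma supp_subset_iff {s : ℕ} {k : Fin s → ℕ} {u : Finset (Fin s)} :
    supp k ⊆ u ↔ ∀ j ∉ u, k j = 0 := by
  simp only [Finset.subset_iff, mem_supp]
  exact forall_congr' fun j => not_imp_comm

lemma hasSum_prod_walshSeries {s m : ℕ} (p : (ZMod 2)[X]) (q : Fin s → (ZMod 2)[X])
    (u : Finset (Fin s)) (n n' : Fin (2 ^ m)) :
    HasSum ({k | supp k ⊆ u}.indicator fun k => (∏ j, psi (k j)) *
      (chi (residue p (truncPoly m n * ∑ j, truncPoly m (k j) * q j)) *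
        chi (residue p (truncPoly m n' * ∑ j, truncPoly m (k j) * q j))))
      (∏ j ∈ u, walshSeries fun i => digitSign (Real.digits (latticePoint m p q n j) 2 i) *
        digitSign (Real.digits (latticePoint m p q n' j) 2 i)) := by
  simp only [walshSeries_latticePoint, ← AddChar.map_add_eq_mul, ← map_add, ← add_mul,
    ← prod_psi_mul_chi, supp_subset_iff]
  refine hasSum_indicator_prod (f := fun j k => psi k *
    chi (residue p (truncPoly m k * ((truncPoly m n + truncPoly m n') * q j))))
    (fun j => ?_) (fun j => ?_) u
  · simpa only [norm_mul, Real.norm_eq_abs, abs_chi, mul_one, Real.rpow_one] using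
      (summable_psi_rpow (r := 1) (by norm_num)).norm
  · simp [psi_zero, truncPoly_zero]

lemma hasSum_indicator_dualLattice {s : ℕ} {p : (ZMod 2)[X]} (hp : Irreducible p)
    (q : Fin s → (ZMod 2)[X]) (u : Finset (Fin s)) :
    HasSum ((dualLattice p.natDegree p q ∩ {k | supp k ⊆ u}).indicator fun k => ∏ j, psi (k j))
      ((∑ n, ∑ n', ∏ j ∈ u, walshSeries fun i =>
        digitSign (Real.digits (latticePoint p.natDegree p q n j) 2 i) *
          digitSign (Real.digits (latticePoint p.natDegree p q n' j) 2 i)) /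
        ((2 ^ p.natDegree : ℕ) : ℝ) ^ 2) := by
  classical
  refine ((hasSum_sum fun n _ => hasSum_sum fun n' _ =>
    hasSum_prod_walshSeries p q u n n').div_const _).congr_fun fun k => ?_
  have hmem : k ∈ dualLattice p.natDegree p q ↔
      p ∣ ∑ j, truncPoly p.natDegree (k j) * q j := Iff.rfl
  by_cases hk : supp k ⊆ u
  · simp only [Set.indicator_apply, Set.mem_inter_iff, Set.mem_ofPred_eq, hk, and_true, if_true,
      ← Finset.mul_sum, ← Finset.sum_mul, sum_chi_residue hp, hmem]
    split_ifs
    · push_cast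
      field_simp
    · simp
  · simp [hk]

/-- The sum of `ψ` over the dual lattice vectors whose set of nonzero components is `v`. -/
noncomputable def dualSum {s : ℕ} (m : ℕ) (p : (ZMod 2)[X]) (q : Fin s → (ZMod 2)[X])
    (v : Finset (Fin s)) : ℝ :=
  ∑' k : {k : Fin s → ℕ // k ∈ dualLattice m p q ∧ ∀ j, k j ≠ 0 ↔ j ∈ v}, ∏ j, psi (k.1 j)

lemma dualSum_eq_tsum {s : ℕ} (m : ℕ) (p : (ZMod 2)[X]) (q : Fin s → (ZMod 2)[X])
    (v : Finset (Fin s)) :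
    dualSum m p q v =
      ∑' k : (dualLattice m p q ∩ {k | supp k = v} : Set (Fin s → ℕ)), ∏ j, psi (k.1 j) := by
  have hset : dualLattice m p q ∩ {k | supp k = v} =
      {k | k ∈ dualLattice m p q ∧ ∀ j, k j ≠ 0 ↔ j ∈ v} := by
    ext k
    simp only [Set.mem_inter_iff, Set.mem_ofPred_eq, supp_eq_iff]
  rw [hset]
  rfl

lemma summable_prod_psi (s : ℕ) : Summable fun k : Fin s → ℕ => ∏ j, psi (k j) := by
  refine (hasSum_pi_prod (fun _ => psi) fun _ => ?_).2.summable
  simpa only [Real.rpow_one] using (summable_psi_rpow (r := 1) (by norm_num)).norm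

lemma sum_powerset_dualSum {s : ℕ} (m : ℕ) (p : (ZMod 2)[X]) (q : Fin s → (ZMod 2)[X])
    (u : Finset (Fin s)) :
    ∑ v ∈ u.powerset, dualSum m p q v =
      ∑' k, (dualLattice m p q ∩ {k | supp k ⊆ u}).indicator (fun k => ∏ j, psi (k j)) k := by
  have hunion : ⋃ v ∈ u.powerset, dualLattice m p q ∩ {k | supp k = v} =
      dualLattice m p q ∩ {k | supp k ⊆ u} := by
    ext k
    simp
  have hdisj : (u.powerset : Set (Finset (Fin s))).Pairwise
      (Function.onFun Disjoint fun v => dualLattice m p q ∩ {k | supp k = v}) :=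
    fun v _ w _ hvw => Set.disjoint_left.2 fun k hkv hkw => hvw (hkv.2.symm.trans hkw.2)
  rw [← tsum_subtype, ← hunion, Summable.tsum_finset_bUnion_disjoint hdisj fun v _ =>
    (summable_prod_psi s).subtype _]
  simp only [dualSum_eq_tsum]

lemma dualSum_empty {s : ℕ} (m : ℕ) (p : (ZMod 2)[X]) (q : Fin s → (ZMod 2)[X]) :
    dualSum m p q ∅ = 1 := by
  have hzero : dualLattice m p q ∩ {k | supp k = ∅} = {0} := by
    ext k
    simp only [Set.mem_inter_iff, Set.mem_ofPred_eq, supp_eq_iff, Set.mem_singleton_iff,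
      Finset.notMem_empty, iff_false, not_not, funext_iff, Pi.zero_apply, and_iff_right_iff_imp]
    intro hk
    simp [dualLattice, hk, truncPoly_zero]
  rw [dualSum_eq_tsum, hzero]
  simp [psi_zero]

lemma sum_mul_sum_powerset_sub {ι R : Type*} [Fintype ι] [DecidableEq ι] [Ring R]
    (a S : Finset ι → R) :
    ∑ u : Finset ι with u.Nonempty, a u * (∑ v ∈ u.powerset, S v - S ∅) =
      ∑ v : Finset ι with v.Nonempty, (∑ u with v ⊆ u, a u) * S v := by
  simp only [← Finset.sum_erase_eq_sub (Finset.empty_mem_powerset _), Finset.mul_sum,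
    Finset.sum_mul]
  refine Finset.sum_comm' fun u v => ?_
  simp only [Finset.mem_filter_univ, Finset.mem_erase, Finset.mem_powerset,
    ← Finset.nonempty_iff_ne_empty]
  exact ⟨fun h => ⟨h.2.2, h.2.1⟩, fun h => ⟨h.2.mono h.1, h.2, h.1⟩⟩

theorem meanSquareL2_latticePoint {s : ℕ} {γ : Finset (Fin s) → ℝ} (hγ : ∀ u, 0 ≤ γ u)
    {p : (ZMod 2)[X]} (hp : Irreducible p) (q : Fin s → (ZMod 2)[X]) :
    meanSquareL2 γ (latticePoint p.natDegree p q) = criterion γ p.natDegree p s q := by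
  rw [meanSquareL2_eq _ (by positivity) hγ, criterion]
  simp only [← (hasSum_indicator_dualLattice hp q _).tsum_eq, ← sum_powerset_dualSum,
    ← dualSum_empty p.natDegree p q, sum_mul_sum_powerset_sub, Fin.is_lt, implies_true, and_true]
  rfl

/-! ### Averaging over the candidates for one component -/

lemma psi_two_pow_mul (m : ℕ) {k : ℕ} (hk : k ≠ 0) : 4 ^ m * psi (2 ^ m * k) = psi k := by
  rw [psi, psi, mul_comm (2 ^ m), ← Nat.shiftLeft_eq, Nat.size_shiftLeft hk, pow_add]
  field_simp

lemma two_pow_mul_psi_rpow_le {r : ℝ} (hr : 1 / 2 ≤ r) (m : ℕ) {k : ℕ} (hk : k ≠ 0) :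
    2 ^ m * ENNReal.ofReal (psi (2 ^ m * k)) ^ r ≤ ENNReal.ofReal (psi k) ^ r := by
  have hfour : (2 : ℝ≥0∞) ^ m ≤ (4 ^ m) ^ r := by
    calc (2 : ℝ≥0∞) ^ m = (4 ^ m) ^ (1 / 2 : ℝ) := by
          rw [show (4 : ℝ≥0∞) = 2 ^ 2 by norm_num, pow_right_comm, ← ENNReal.rpow_natCast _ 2,
            ← ENNReal.rpow_mul]
          norm_num
      _ ≤ (4 ^ m) ^ r := ENNReal.rpow_le_rpow_of_exponent_le (one_le_pow₀ (by norm_num)) hr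
  calc 2 ^ m * ENNReal.ofReal (psi (2 ^ m * k)) ^ r
      ≤ (4 ^ m) ^ r * ENNReal.ofReal (psi (2 ^ m * k)) ^ r := by gcongr
    _ = ENNReal.ofReal (psi k) ^ r := by
        rw [← ENNReal.mul_rpow_of_nonneg _ _ (by linarith), ← psi_two_pow_mul m hk,
          ENNReal.ofReal_mul (by positivity), ENNReal.ofReal_pow (by norm_num),
          ENNReal.ofReal_ofNat]

lemma exists_finset_candidates (m : ℕ) :
    ∃ T : Finset (ZMod 2)[X], (∀ f ∈ T, f ∈ candidates m) ∧ T.card = 2 ^ m - 1 := by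
  classical
  refine ⟨(Finset.univ.map (Function.Embedding.subtype (· ∈ degreeLT (ZMod 2) m))).erase 0,
    fun f hf => ?_, ?_⟩
  · simpa [candidates, Polynomial.mem_degreeLT] using hf
  · rw [Finset.card_erase_of_mem (by simp), Finset.card_map, Finset.card_univ, card_degreeLT]

lemma not_dvd_of_mem_candidates {p f : (ZMod 2)[X]} (hp : p ≠ 0)
    (hf : f ∈ candidates p.natDegree) : ¬p ∣ f :=
  Polynomial.not_dvd_of_degree_lt hf.1 (Polynomial.degree_eq_natDegree hp ▸ hf.2)

lemma dvd_truncPoly_iff {p : (ZMod 2)[X]} (hp : p ≠ 0) {a : ℕ} :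
    p ∣ truncPoly p.natDegree a ↔ 2 ^ p.natDegree ∣ a := by
  rw [← truncPoly_eq_zero_iff]
  refine ⟨fun h => ?_, fun h => h ▸ dvd_zero p⟩
  by_contra h0
  exact not_dvd_of_mem_candidates hp ⟨h0, degree_truncPoly_lt _ a⟩ h

lemma tsum_multiples {N : ℕ} (hN : N ≠ 0) (w : ℕ → ℝ≥0∞) :
    ∑' a : {a | a ≠ 0 ∧ N ∣ a}, w a = ∑' b : {b : ℕ | b ≠ 0}, w (N * b) := by
  have himage : {a | a ≠ 0 ∧ N ∣ a} = (N * ·) '' {b | b ≠ 0} := by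
    ext a
    constructor
    · rintro ⟨ha, b, rfl⟩
      exact ⟨b, right_ne_zero_of_mul ha, rfl⟩
    · rintro ⟨b, hb, rfl⟩
      exact ⟨mul_ne_zero hN hb, dvd_mul_right N b⟩
  rw [himage, tsum_image w (mul_right_injective₀ hN).injOn]

lemma sum_tsum_le_of_dvd {p : (ZMod 2)[X]} (hp : Irreducible p) {T : Finset (ZMod 2)[X]}
    (hT : ∀ f ∈ T, f ∈ candidates p.natDegree) (hcard : T.card ≤ 2 ^ p.natDegree)
    {w : ℕ → ℝ≥0∞} (hw : ∀ a ≠ 0, 2 ^ p.natDegree * w (2 ^ p.natDegree * a) ≤ w a)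
    {h : (ZMod 2)[X]} (hh : p ∣ h) :
    ∑ f ∈ T, ∑' a : {a | a ≠ 0 ∧ p ∣ truncPoly p.natDegree a * f + h}, w a ≤
      ∑' a : {a : ℕ | a ≠ 0}, w a := by
  have hdvd (f) (hf : f ∈ T) (a : ℕ) :
      p ∣ truncPoly p.natDegree a * f + h ↔ 2 ^ p.natDegree ∣ a := by
    rw [dvd_add_left hh, hp.prime.dvd_mul,
      or_iff_left (not_dvd_of_mem_candidates hp.ne_zero (hT f hf)), dvd_truncPoly_iff hp.ne_zero]
  calc ∑ f ∈ T, ∑' a : {a | a ≠ 0 ∧ p ∣ truncPoly p.natDegree a * f + h}, w a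
      = ∑ f ∈ T, ∑' b : {b : ℕ | b ≠ 0}, w (2 ^ p.natDegree * b) :=
        Finset.sum_congr rfl fun f hf => by
          rw [Set.ext fun a => and_congr_right fun _ => hdvd f hf a,
            ← tsum_multiples (pow_ne_zero p.natDegree two_ne_zero)]
    _ ≤ 2 ^ p.natDegree * ∑' b : {b : ℕ | b ≠ 0}, w (2 ^ p.natDegree * b) := by
        rw [Finset.sum_const, nsmul_eq_mul]
        gcongr
        exact_mod_cast hcard
    _ ≤ ∑' a : {a : ℕ | a ≠ 0}, w a := by
        rw [← ENNReal.tsum_mul_left]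
        exact ENNReal.tsum_le_tsum fun a => hw a a.2

lemma sum_tsum_le_of_not_dvd {p : (ZMod 2)[X]} (hp : Irreducible p) {T : Finset (ZMod 2)[X]}
    (hT : ∀ f ∈ T, f ∈ candidates p.natDegree) (w : ℕ → ℝ≥0∞) {h : (ZMod 2)[X]} (hh : ¬p ∣ h) :
    ∑ f ∈ T, ∑' a : {a | a ≠ 0 ∧ p ∣ truncPoly p.natDegree a * f + h}, w a ≤
      ∑' a : {a : ℕ | a ≠ 0}, w a := by
  classical
  simp only [tsum_subtype (f := w)]
  rw [← Summable.tsum_finsetSum fun _ _ => ENNReal.summable]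
  refine ENNReal.tsum_le_tsum fun a => ?_
  by_cases ha : a = 0
  · simp [ha]
  have hunique : (T.filter fun f => p ∣ truncPoly p.natDegree a * f + h).card ≤ 1 := by
    refine Finset.card_le_one.2 fun f hf g hg => ?_
    rw [Finset.mem_filter] at hf hg
    have hna : ¬p ∣ truncPoly p.natDegree a := fun hd =>
      hh ((dvd_add_right (hd.mul_right f)).1 hf.2)
    have hsub : p ∣ truncPoly p.natDegree a * (f - g) := by
      simpa only [add_sub_add_right_eq_sub, ← mul_sub] using dvd_sub hf.2 hg.2
    by_contra hfg
    refine not_dvd_of_mem_candidates hp.ne_zero ⟨sub_ne_zero.2 hfg, ?_⟩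
      ((hp.prime.dvd_or_dvd hsub).resolve_left hna)
    exact (Polynomial.degree_sub_le f g).trans_lt (max_lt (hT f hf.1).2 (hT g hg.1).2)
  simp only [Set.indicator_apply, Set.mem_ofPred_eq, ne_eq, ha, not_false_eq_true, true_and,
    if_true, ← Finset.sum_filter, Finset.sum_const]
  exact (nsmul_le_nsmul_left zero_le hunique).trans_eq (one_nsmul _)

/-! ### The component-by-component bound -/

section CBC

variable {s m : ℕ} {γ : Finset (Fin s) → ℝ} {p : (ZMod 2)[X]} {q : Fin s → (ZMod 2)[X]}
  {k : Fin s → ℕ} {j : Fin s}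

lemma gammaTilde_nonneg (hγ : ∀ u, 0 ≤ γ u) (v : Finset (Fin s)) : 0 ≤ gammaTilde γ v :=
  Finset.sum_nonneg fun u _ => div_nonneg (hγ u) (by positivity)

/-- The contribution of a dual lattice vector `k` to the criterion. -/
noncomputable def weight (γ : Finset (Fin s) → ℝ) (k : Fin s → ℕ) : ℝ≥0∞ :=
  ENNReal.ofReal (gammaTilde γ (supp k) * ∏ j, psi (k j))

/-- The vectors whose last nonzero component has index `j`. -/
def lastNonzero (j : Fin s) : Set (Fin s → ℕ) := {k | k j ≠ 0 ∧ ∀ i, k i ≠ 0 → i ≤ j}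

/-- The part of the criterion that enters with the component `q j`: the contribution of the dual
lattice vectors whose last nonzero component has index `j`. -/
noncomputable def lastPart (γ : Finset (Fin s) → ℝ) (m : ℕ) (p : (ZMod 2)[X])
    (q : Fin s → (ZMod 2)[X]) (j : Fin s) : ℝ≥0∞ :=
  ∑' k : (lastNonzero j ∩ dualLattice m p q : Set (Fin s → ℕ)), weight γ k

lemma pairwise_disjoint_lastNonzero (s : ℕ) :
    Pairwise (Function.onFun Disjoint (lastNonzero : Fin s → Set (Fin s → ℕ))) :=
  fun i j hij => Set.disjoint_left.2 fun _ hi hj => hij ((hj.2 i hi.1).antisymm (hi.2 j hj.1))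

lemma exists_mem_lastNonzero (hk : (supp k).Nonempty) : ∃ j ∈ supp k, k ∈ lastNonzero j :=
  ⟨_, Finset.max'_mem _ hk, mem_supp.1 (Finset.max'_mem _ hk),
    fun _ hi => Finset.le_max' _ _ (mem_supp.2 hi)⟩

lemma ofReal_gammaTilde_mul_dualSum (hγ : ∀ u, 0 ≤ γ u) (m : ℕ) (p : (ZMod 2)[X])
    (q : Fin s → (ZMod 2)[X]) (v : Finset (Fin s)) :
    ENNReal.ofReal (gammaTilde γ v * dualSum m p q v) =
      ∑' k : (dualLattice m p q ∩ {k | supp k = v} : Set (Fin s → ℕ)), weight γ k := by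
  rw [dualSum_eq_tsum, ← tsum_mul_left, ENNReal.ofReal_tsum_of_nonneg]
  · exact tsum_congr fun k => by rw [weight, k.2.2]
  · exact fun k => mul_nonneg (gammaTilde_nonneg hγ v)
      (Finset.prod_nonneg fun _ _ => (psi_pos _).le)
  · exact ((summable_prod_psi s).subtype _).mul_left _

lemma ofReal_criterion (hγ : ∀ u, 0 ≤ γ u) (m : ℕ) (p : (ZMod 2)[X]) (d : ℕ)
    (q : Fin s → (ZMod 2)[X]) :
    ENNReal.ofReal (criterion γ m p d q) = ∑ j with j.val < d, lastPart γ m p q j := by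
  have hsets : ⋃ v ∈ ({v | v.Nonempty ∧ ∀ j ∈ v, j.val < d} : Finset (Finset (Fin s))),
      dualLattice m p q ∩ {k | supp k = v} =
      ⋃ j ∈ ({j | j.val < d} : Finset (Fin s)), lastNonzero j ∩ dualLattice m p q := by
    ext k
    simp only [Set.mem_iUnion, Finset.mem_filter_univ, Set.mem_inter_iff, Set.mem_ofPred_eq,
      exists_prop]
    constructor
    · rintro ⟨v, ⟨hne, hlt⟩, hk, rfl⟩
      obtain ⟨j, hj, hkj⟩ := exists_mem_lastNonzero hne
      exact ⟨j, hlt j hj, hkj, hk⟩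
    · rintro ⟨j, hj, hkj, hk⟩
      exact ⟨supp k, ⟨⟨j, mem_supp.2 hkj.1⟩, fun i hi =>
        lt_of_le_of_lt (hkj.2 i (mem_supp.1 hi)) hj⟩, hk, rfl⟩
  have hnonneg (v : Finset (Fin s)) : 0 ≤ gammaTilde γ v * dualSum m p q v :=
    mul_nonneg (gammaTilde_nonneg hγ v)
      (tsum_nonneg fun _ => Finset.prod_nonneg fun _ _ => (psi_pos _).le)
  calc ENNReal.ofReal (criterion γ m p d q)
      = ∑ v with v.Nonempty ∧ ∀ j ∈ v, j.val < d,
          ∑' k : (dualLattice m p q ∩ {k | supp k = v} : Set (Fin s → ℕ)), weight γ k := by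
        simp only [← ofReal_gammaTilde_mul_dualSum hγ]
        exact ENNReal.ofReal_sum_of_nonneg fun v _ => hnonneg v
    _ = ∑ j with j.val < d, lastPart γ m p q j := by
        rw [← Summable.tsum_finset_bUnion_disjoint _ fun _ _ => ENNReal.summable, hsets,
          Summable.tsum_finset_bUnion_disjoint _ fun _ _ => ENNReal.summable]
        · rfl
        · exact fun i _ j _ hij =>
            ((pairwise_disjoint_lastNonzero s hij).inter_left _).inter_right _
        · exact fun v _ w _ hvw => Set.disjoint_left.2 fun k hv hw => hvw (hv.2.symm.trans hw.2)

lemma mem_dualLattice_update (hk : k j = 0) (f : (ZMod 2)[X]) :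
    k ∈ dualLattice m p (Function.update q j f) ↔ k ∈ dualLattice m p q := by
  have hterm (i : Fin s) : truncPoly m (k i) * Function.update q j f i =
      truncPoly m (k i) * q i := by
    rcases eq_or_ne i j with rfl | hij
    · simp [hk, truncPoly_zero]
    · rw [Function.update_of_ne hij]
  simp only [dualLattice, Set.mem_ofPred_eq, hterm]

lemma lastPart_update (γ : Finset (Fin s) → ℝ) (p : (ZMod 2)[X]) (q : Fin s → (ZMod 2)[X])
    {i : Fin s} (hij : i < j) (f : (ZMod 2)[X]) :
    lastPart γ m p (Function.update q j f) i = lastPart γ m p q i := by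
  have hset : lastNonzero i ∩ dualLattice m p (Function.update q j f) =
      lastNonzero i ∩ dualLattice m p q := by
    ext k
    refine and_congr_right fun hk => mem_dualLattice_update ?_ f
    by_contra hkj
    exact hij.not_ge (hk.2 j hkj)
  rw [lastPart, lastPart, hset]

lemma IsCBC.lastPart_le (hγ : ∀ u, 0 ≤ γ u) (h : IsCBC γ m p q) (j : Fin s)
    {f : (ZMod 2)[X]} (hf : f ∈ candidates m) :
    lastPart γ m p q j ≤ lastPart γ m p (Function.update q j f) j := by
  rcases Nat.eq_zero_or_pos j.val with hj | hj
  · -- `q 0 = 1` is not the result of a minimization, but `p ∣ a * 1` implies `p ∣ a * f`.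
    refine ENNReal.tsum_mono_subtype _ fun k hk => ⟨hk.1, ?_⟩
    have hsingle (g : Fin s → (ZMod 2)[X]) :
        ∑ i, truncPoly m (k i) * g i = truncPoly m (k j) * g j := by
      refine Fintype.sum_eq_single j fun i hij => ?_
      have hki : k i = 0 := by
        by_contra hki
        have hle : i.val ≤ j.val := hk.1.2 i hki
        exact hij (Fin.ext (by lia))
      rw [hki, truncPoly_zero, zero_mul]
    have hdvd : p ∣ ∑ i, truncPoly m (k i) * q i := hk.2
    rw [hsingle, h.first j hj, mul_one] at hdvd
    change p ∣ ∑ i, truncPoly m (k i) * Function.update q j f i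
    rw [hsingle]
    exact hdvd.mul_right _
  · have hmin := ENNReal.ofReal_le_ofReal (h.minimal j hj f hf)
    have hsplit (g : Fin s → (ZMod 2)[X]) : ENNReal.ofReal (criterion γ m p (j.val + 1) g) =
        lastPart γ m p g j + ∑ i ∈ Finset.Iio j, lastPart γ m p g i := by
      have hIic : ({i | i.val < j.val + 1} : Finset (Fin s)) = insert j (Finset.Iio j) := by
        ext i
        simp only [Finset.mem_filter_univ, Finset.mem_insert, Finset.mem_Iio, Fin.ext_iff,
          Fin.lt_def]
        lia
      rw [ofReal_criterion hγ, hIic, Finset.sum_insert Finset.notMem_Iio_self]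
    rw [hsplit, hsplit, Finset.sum_congr rfl fun i hi =>
      lastPart_update γ p q (Finset.mem_Iio.1 hi) f] at hmin
    refine (ENNReal.add_le_add_iff_right ?_).1 hmin
    exact (le_add_self.trans_eq (hsplit q).symm).trans_lt ENNReal.ofReal_lt_top |>.ne

theorem tsum_eq_tsum_update {ι α : Type*} [DecidableEq ι] (j : ι) (c : α)
    (F : (ι → α) → ℝ≥0∞) :
    ∑' k, F k = ∑' k : {k : ι → α // k j = c}, ∑' a, F (Function.update k j a) := by
  let e : {k : ι → α // k j = c} × α ≃ (ι → α) :=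
    { toFun := fun x => Function.update x.1 j x.2
      invFun := fun k => (⟨Function.update k j c, Function.update_self j c k⟩, k j)
      left_inv := fun ⟨⟨k, hk⟩, a⟩ => by simp [← hk]
      right_inv := fun k => by simp }
  rw [← e.tsum_eq, ENNReal.tsum_prod']
  rfl

lemma supp_update {a : ℕ} (ha : a ≠ 0) : supp (Function.update k j a) = insert j (supp k) := by
  ext i
  rcases eq_or_ne i j with rfl | hij <;> simp [mem_supp, *]

lemma prod_psi_update (hk : k j = 0) (a : ℕ) :
    ∏ i, psi (Function.update k j a i) = (∏ i, psi (k i)) * psi a := by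
  simp only [Function.apply_update fun _ => psi, Finset.prod_update_of_mem (Finset.mem_univ j)]
  rw [← Finset.mul_prod_erase _ (fun i => psi (k i)) (Finset.mem_univ j), hk, psi_zero, one_mul,
    Finset.sdiff_singleton_eq_erase, mul_comm]

lemma update_mem_dualLattice_update (hk : k j = 0) (a : ℕ) (f : (ZMod 2)[X]) :
    Function.update k j a ∈ dualLattice m p (Function.update q j f) ↔
      p ∣ truncPoly m a * f + ∑ i, truncPoly m (k i) * q i := by
  have hsum : ∑ i, truncPoly m (Function.update k j a i) * Function.update q j f i =
      truncPoly m a * f + ∑ i, truncPoly m (k i) * q i := by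
    rw [← Finset.add_sum_erase _ _ (Finset.mem_univ j),
      ← Finset.add_sum_erase _ (fun i => truncPoly m (k i) * q i) (Finset.mem_univ j), hk,
      truncPoly_zero, zero_mul, zero_add, Function.update_self, Function.update_self]
    congr 1
    refine Finset.sum_congr rfl fun i hi => ?_
    simp only [Function.update_of_ne (Finset.ne_of_mem_erase hi)]
  rw [← hsum]
  rfl

lemma update_mem_lastNonzero_iff {a : ℕ} :
    Function.update k j a ∈ lastNonzero j ↔ a ≠ 0 ∧ ∀ i, k i ≠ 0 → i ≤ j := by
  simp only [lastNonzero, Set.mem_ofPred_eq, Function.update_self]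
  refine and_congr_right fun _ => forall_congr' fun i => ?_
  rcases eq_or_ne i j with rfl | hij <;> simp [*]

lemma weight_update (hγ : ∀ u, 0 ≤ γ u) (hk : k j = 0) {a : ℕ} (ha : a ≠ 0) :
    weight γ (Function.update k j a) =
      ENNReal.ofReal (gammaTilde γ (insert j (supp k)) * ∏ i, psi (k i)) *
        ENNReal.ofReal (psi a) := by
  rw [weight, supp_update ha, prod_psi_update hk, ← mul_assoc, ENNReal.ofReal_mul]
  exact mul_nonneg (gammaTilde_nonneg hγ _) (Finset.prod_nonneg fun _ _ => (psi_pos _).le)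

lemma exists_indicator_weight_rpow_update (hγ : ∀ u, 0 ≤ γ u) {r : ℝ} (hr : 0 ≤ r)
    (hk : k j = 0) :
    ∃ c : ℝ≥0∞, ∀ (A : Set (Fin s → ℕ)) (a : ℕ),
      (lastNonzero j ∩ A).indicator (fun k => weight γ k ^ r) (Function.update k j a) =
        c * {a | a ≠ 0 ∧ Function.update k j a ∈ A}.indicator
          (fun a => ENNReal.ofReal (psi a) ^ r) a := by
  classical
  by_cases hlast : ∀ i, k i ≠ 0 → i ≤ j
  · refine ⟨ENNReal.ofReal (gammaTilde γ (insert j (supp k)) * ∏ i, psi (k i)) ^ r, fun A a => ?_⟩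
    simp only [Set.indicator_apply, Set.mem_inter_iff, update_mem_lastNonzero_iff,
      Set.mem_ofPred_eq, and_iff_left hlast]
    split_ifs with ha
    · rw [weight_update hγ hk ha.1, ENNReal.mul_rpow_of_nonneg _ _ hr]
    · rw [mul_zero]
  · refine ⟨0, fun A a => ?_⟩
    rw [zero_mul, Set.indicator_of_notMem fun h => hlast (update_mem_lastNonzero_iff.1 h.1).2]

lemma sum_tsum_weight_rpow_le (hγ : ∀ u, 0 ≤ γ u) {r : ℝ} (hr : 1 / 2 ≤ r)
    (hp : Irreducible p) {T : Finset (ZMod 2)[X]} (hT : ∀ f ∈ T, f ∈ candidates p.natDegree)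
    (hcard : T.card ≤ 2 ^ p.natDegree) (q : Fin s → (ZMod 2)[X]) (j : Fin s) :
    ∑ f ∈ T, ∑' k : (lastNonzero j ∩ dualLattice p.natDegree p (Function.update q j f) :
        Set (Fin s → ℕ)), weight γ k ^ r ≤
      ∑' k : (lastNonzero j : Set (Fin s → ℕ)), weight γ k ^ r := by
  simp only [tsum_subtype (f := fun k => weight γ k ^ r), tsum_eq_tsum_update j 0]
  rw [← Summable.tsum_finsetSum fun _ _ => ENNReal.summable]
  refine ENNReal.tsum_le_tsum fun ⟨k, hk⟩ => ?_
  obtain ⟨c, hc⟩ := exists_indicator_weight_rpow_update hγ (by linarith) hk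
  have hcuniv := hc Set.univ
  simp only [Set.inter_univ, Set.mem_univ, and_true] at hcuniv
  simp only [hc, hcuniv, update_mem_dualLattice_update hk, ENNReal.tsum_mul_left,
    ← Finset.mul_sum, ← tsum_subtype]
  gcongr
  by_cases hdvd : p ∣ ∑ i, truncPoly p.natDegree (k i) * q i
  · exact sum_tsum_le_of_dvd (w := fun a => ENNReal.ofReal (psi a) ^ r) hp hT hcard
      (fun a ha => two_pow_mul_psi_rpow_le hr _ ha) hdvd
  · exact sum_tsum_le_of_not_dvd hp hT (fun a => ENNReal.ofReal (psi a) ^ r) hdvd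

lemma IsCBC.mul_lastPart_rpow_le (hγ : ∀ u, 0 ≤ γ u) {r : ℝ} (hr : 1 / 2 ≤ r)
    (hr1 : r ≤ 1) (h : IsCBC γ m p q) (j : Fin s) :
    ((2 ^ m - 1 : ℕ) : ℝ≥0∞) * lastPart γ m p q j ^ r ≤
      ∑' k : (lastNonzero j : Set (Fin s → ℕ)), weight γ k ^ r := by
  obtain rfl := h.natDegree_eq
  obtain ⟨T, hT, hcard⟩ := exists_finset_candidates p.natDegree
  calc ((2 ^ p.natDegree - 1 : ℕ) : ℝ≥0∞) * lastPart γ p.natDegree p q j ^ r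
      = ∑ _ ∈ T, lastPart γ p.natDegree p q j ^ r := by
        rw [Finset.sum_const, hcard, nsmul_eq_mul]
    _ ≤ ∑ f ∈ T, lastPart γ p.natDegree p (Function.update q j f) j ^ r :=
        Finset.sum_le_sum fun f hf =>
          ENNReal.rpow_le_rpow (h.lastPart_le hγ j (hT f hf)) (by linarith)
    _ ≤ ∑ f ∈ T, ∑' k : (lastNonzero j ∩ dualLattice p.natDegree p (Function.update q j f) :
          Set (Fin s → ℕ)), weight γ k ^ r :=
        Finset.sum_le_sum fun f _ => rpow_tsum_le_tsum_rpow _ (by linarith) hr1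
    _ ≤ ∑' k : (lastNonzero j : Set (Fin s → ℕ)), weight γ k ^ r :=
        sum_tsum_weight_rpow_le hγ hr h.irreducible hT (hcard.trans_le (Nat.sub_le _ _)) q j

theorem IsCBC.mul_criterion_rpow_le (hγ : ∀ u, 0 ≤ γ u) {r : ℝ} (hr : 1 / 2 ≤ r)
    (hr1 : r ≤ 1) (h : IsCBC γ m p q) :
    ((2 ^ m - 1 : ℕ) : ℝ≥0∞) * ENNReal.ofReal (criterion γ m p s q) ^ r ≤
      ∑' k : {k : Fin s → ℕ | k ≠ 0}, weight γ k ^ r := by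
  have hcrit : ENNReal.ofReal (criterion γ m p s q) = ∑' j, lastPart γ m p q j := by
    rw [ofReal_criterion hγ, tsum_fintype, Finset.filter_true_of_mem fun j _ => j.isLt]
  have hsub : ⋃ j, lastNonzero j ⊆ {k : Fin s → ℕ | k ≠ 0} := by
    refine Set.iUnion_subset fun j k hk => ?_
    rintro rfl
    exact hk.1 rfl
  calc ((2 ^ m - 1 : ℕ) : ℝ≥0∞) * ENNReal.ofReal (criterion γ m p s q) ^ r
      ≤ ((2 ^ m - 1 : ℕ) : ℝ≥0∞) * ∑' j, lastPart γ m p q j ^ r := by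
        rw [hcrit]
        gcongr
        exact rpow_tsum_le_tsum_rpow _ (by linarith) hr1
    _ = ∑' j, ((2 ^ m - 1 : ℕ) : ℝ≥0∞) * lastPart γ m p q j ^ r := ENNReal.tsum_mul_left.symm
    _ ≤ ∑' j, ∑' k : (lastNonzero j : Set (Fin s → ℕ)), weight γ k ^ r :=
        ENNReal.tsum_le_tsum (h.mul_lastPart_rpow_le hγ hr hr1)
    _ = ∑' k : (⋃ j, lastNonzero j : Set (Fin s → ℕ)), weight γ k ^ r :=
        (ENNReal.tsum_biUnion (f := fun k => weight γ k ^ r)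
          ((pairwise_disjoint_lastNonzero s).set_pairwise _)).symm
    _ ≤ ∑' k : {k : Fin s → ℕ | k ≠ 0}, weight γ k ^ r :=
        ENNReal.tsum_mono_subtype (fun k => weight γ k ^ r) hsub

end CBC

/-! ### Summation over all indices -/

lemma hasSum_prod_psi_rpow {s : ℕ} {lam : ℝ} (hlam : 1 / 2 < lam) (u : Finset (Fin s)) :
    HasSum ({k : Fin s → ℕ | k ≠ 0 ∧ supp k ⊆ u}.indicator fun k => ∏ j, psi (k j) ^ lam)
      (-1 + (((2 : ℝ) ^ (2 * lam) - 1) / ((2 : ℝ) ^ (2 * lam) - 2)) ^ u.card) := by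
  classical
  have hall := hasSum_indicator_prod (f := fun (_ : Fin s) k => psi k ^ lam)
    (fun _ => (summable_psi_rpow hlam).norm) (fun _ => by rw [psi_zero, Real.one_rpow]) u
  simp only [← supp_subset_iff, tsum_psi_rpow hlam, Finset.prod_const] at hall
  convert! (hasSum_ite_eq (0 : Fin s → ℕ) (-1 : ℝ)).add hall using 2 with k
  rcases eq_or_ne k 0 with rfl | hk
  · simp [supp, psi_zero]
  · simp [Set.indicator_apply, hk]

/-- The sum in the numerator of `weightRatio`. -/
noncomputable def weightSum {s : ℕ} (γ : Finset (Fin s) → ℝ) (lam : ℝ) : ℝ :=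
  ∑ u : Finset (Fin s) with u.Nonempty, (γ u / 3 ^ u.card) ^ lam *
    (-1 + (((2 : ℝ) ^ (2 * lam) - 1) / ((2 : ℝ) ^ (2 * lam) - 2)) ^ u.card)

section

variable {s : ℕ} {γ : Finset (Fin s) → ℝ} {lam : ℝ}

lemma weightSum_term_nonneg (hγ : ∀ u, 0 ≤ γ u) (hlam : 1 / 2 < lam) (u : Finset (Fin s)) :
    0 ≤ (γ u / 3 ^ u.card) ^ lam *
      (-1 + (((2 : ℝ) ^ (2 * lam) - 1) / ((2 : ℝ) ^ (2 * lam) - 2)) ^ u.card) :=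
  mul_nonneg (Real.rpow_nonneg (div_nonneg (hγ u) (by positivity)) _) <|
    (hasSum_prod_psi_rpow hlam u).nonneg <| Set.indicator_nonneg fun _ _ =>
      Finset.prod_nonneg fun _ _ => Real.rpow_nonneg (psi_pos _).le _

lemma weightSum_nonneg (hγ : ∀ u, 0 ≤ γ u) (hlam : 1 / 2 < lam) : 0 ≤ weightSum γ lam :=
  Finset.sum_nonneg fun u _ => weightSum_term_nonneg hγ hlam u

lemma weight_rpow_le (hγ : ∀ u, 0 ≤ γ u) (h0 : 0 < lam) (h1 : lam ≤ 1) (k : Fin s → ℕ) :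
    weight γ k ^ lam ≤ ∑ u : Finset (Fin s) with supp k ⊆ u,
      ENNReal.ofReal ((γ u / 3 ^ u.card) ^ lam * ∏ j, psi (k j) ^ lam) := by
  have hc (u : Finset (Fin s)) : 0 ≤ γ u / 3 ^ u.card := div_nonneg (hγ u) (by positivity)
  have hpsi : 0 ≤ ∏ j, psi (k j) := Finset.prod_nonneg fun _ _ => (psi_pos _).le
  rw [weight, gammaTilde, Finset.sum_mul,
    ENNReal.ofReal_sum_of_nonneg fun u _ => mul_nonneg (hc u) hpsi]
  refine (Finset.le_sum_of_subadditive (fun x : ℝ≥0∞ => x ^ lam) (by simp [h0])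
    (fun x y => ENNReal.rpow_add_le_add_rpow x y h0.le h1) _ _).trans_eq ?_
  refine Finset.sum_congr rfl fun u _ => ?_
  rw [ENNReal.ofReal_rpow_of_nonneg (mul_nonneg (hc u) hpsi) h0.le, Real.mul_rpow (hc u) hpsi,
    Real.finsetProd_rpow _ _ fun _ _ => (psi_pos _).le]

lemma tsum_weight_rpow_le (hγ : ∀ u, 0 ≤ γ u) (hlam : 1 / 2 < lam) (hlam' : lam ≤ 1) :
    ∑' k : {k : Fin s → ℕ | k ≠ 0}, weight γ k ^ lam ≤ ENNReal.ofReal (weightSum γ lam) := by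
  let S (u : Finset (Fin s)) : Set (Fin s → ℕ) := {k | k ≠ 0 ∧ supp k ⊆ u}
  let F (u : Finset (Fin s)) (k : Fin s → ℕ) : ℝ :=
    (γ u / 3 ^ u.card) ^ lam * (S u).indicator (fun k => ∏ j, psi (k j) ^ lam) k
  have hF (u : Finset (Fin s)) (k : Fin s → ℕ) : 0 ≤ F u k :=
    mul_nonneg (Real.rpow_nonneg (div_nonneg (hγ u) (by positivity)) _) <|
      Set.indicator_nonneg (fun _ _ => Finset.prod_nonneg fun _ _ =>
        Real.rpow_nonneg (psi_pos _).le _) k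
  have hsum (u : Finset (Fin s)) :=
    (hasSum_prod_psi_rpow hlam u).mul_left ((γ u / 3 ^ u.card) ^ lam)
  have hle (k : Fin s → ℕ) (hk : k ≠ 0) :
      weight γ k ^ lam ≤ ∑ u with u.Nonempty, ENNReal.ofReal (F u k) := by
    refine (weight_rpow_le hγ (by linarith) hlam' k).trans ?_
    have hsub : ({u | supp k ⊆ u} : Finset (Finset (Fin s))) ⊆ ({u | u.Nonempty} : Finset _) := by
      intro u hu
      obtain ⟨j, hj⟩ := Function.ne_iff.1 hk
      exact Finset.mem_filter_univ _ |>.2 ⟨j, (Finset.mem_filter_univ _).1 hu (mem_supp.2 hj)⟩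
    refine (Finset.sum_le_sum fun u hu => ?_).trans (Finset.sum_le_sum_of_subset hsub)
    have hkS : k ∈ S u := ⟨hk, (Finset.mem_filter_univ _).1 hu⟩
    simp only [F, Set.indicator_of_mem hkS, le_refl]
  calc ∑' k : {k : Fin s → ℕ | k ≠ 0}, weight γ k ^ lam
      ≤ ∑' k : {k : Fin s → ℕ | k ≠ 0}, ∑ u with u.Nonempty, ENNReal.ofReal (F u k) :=
        ENNReal.tsum_le_tsum fun k => hle k k.2
    _ ≤ ∑' k, ∑ u with u.Nonempty, ENNReal.ofReal (F u k) :=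
        ENNReal.tsum_comp_le_tsum_of_injective Subtype.val_injective _
    _ = ∑ u with u.Nonempty, ENNReal.ofReal (∑' k, F u k) := by
        rw [Summable.tsum_finsetSum fun _ _ => ENNReal.summable]
        exact Finset.sum_congr rfl fun u _ =>
          (ENNReal.ofReal_tsum_of_nonneg (hF u) (hsum u).summable).symm
    _ = ENNReal.ofReal (weightSum γ lam) := by
        rw [weightSum, ENNReal.ofReal_sum_of_nonneg fun u _ => weightSum_term_nonneg hγ hlam u]
        exact Finset.sum_congr rfl fun u _ => by rw [← (hsum u).tsum_eq]

lemma meanSquareL2_nonneg {N : ℕ} (γ : Finset (Fin s) → ℝ) (x : Fin N → Fin s → ℝ) :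
    0 ≤ meanSquareL2 γ x :=
  integral_nonneg fun _ => sq_nonneg _

theorem IsCBC.two_pow_mul_meanSquareL2_rpow_le (hγ : ∀ u, 0 ≤ γ u) (hlam : 1 / 2 < lam)
    (hlam' : lam ≤ 1) {m : ℕ} {p : (ZMod 2)[X]} {q : Fin s → (ZMod 2)[X]}
    (h : IsCBC γ (m + 1) p q) :
    2 ^ m * meanSquareL2 γ (latticePoint (m + 1) p q) ^ lam ≤ weightSum γ lam := by
  have hE : meanSquareL2 γ (latticePoint (m + 1) p q) = criterion γ (m + 1) p s q := by
    rw [← h.natDegree_eq, meanSquareL2_latticePoint hγ h.irreducible]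
  have hE0 := meanSquareL2_nonneg γ (latticePoint (m + 1) p q)
  have hbound := (h.mul_criterion_rpow_le hγ hlam.le hlam').trans
    (tsum_weight_rpow_le hγ hlam hlam')
  rw [← hE, ENNReal.ofReal_rpow_of_nonneg hE0 (by linarith), ← ENNReal.ofReal_natCast,
    ← ENNReal.ofReal_mul (Nat.cast_nonneg _),
    ENNReal.ofReal_le_ofReal_iff (weightSum_nonneg hγ hlam)] at hbound
  refine le_trans ?_ hbound
  have htwo : 2 ^ m ≤ 2 ^ (m + 1) - 1 := by
    have := Nat.one_le_two_pow (n := m)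
    lia
  gcongr
  exact_mod_cast htwo

/-! ### Tractability -/

lemma weightSum_le (hγ : ∀ u, 0 ≤ γ u) (hlam : 1 / 2 < lam) {B : ℝ}
    (hB : weightRatio γ lam ≤ B) : weightSum γ lam ≤ (B * initialMeanSquareL2 γ) ^ lam := by
  have h0 : 0 < lam := by linarith
  have hI := meanSquareL2_nonneg γ fun n : Fin 0 => n.elim0
  rcases hI.eq_or_lt with hzero | hpos
  · replace hzero : initialMeanSquareL2 γ = 0 := hzero.symm
    have hγzero := (Finset.sum_eq_zero_iff_of_nonneg fun u _ =>
      div_nonneg (hγ u) (by positivity)).1 ((initialMeanSquareL2_eq hγ).symm.trans hzero)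
    rw [hzero, mul_zero, Real.zero_rpow h0.ne', weightSum]
    refine (Finset.sum_eq_zero fun u hu => ?_).le
    rw [hγzero u hu, Real.zero_rpow h0.ne', zero_mul]
  · have hratio : weightRatio γ lam = weightSum γ lam ^ (1 / lam) / initialMeanSquareL2 γ := by
      rw [initialMeanSquareL2_eq hγ]
      rfl
    calc weightSum γ lam = (weightSum γ lam ^ (1 / lam)) ^ lam := by
          rw [← Real.rpow_mul (weightSum_nonneg hγ hlam), one_div_mul_cancel h0.ne', Real.rpow_one]
      _ ≤ (B * initialMeanSquareL2 γ) ^ lam :=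
          Real.rpow_le_rpow (Real.rpow_nonneg (weightSum_nonneg hγ hlam) _)
            ((div_le_iff₀ hpos).1 (hratio.symm.trans_le hB)) h0.le

theorem IsCBC.meanSquareL2_le (hγ : ∀ u, 0 ≤ γ u) (hlam : 1 / 2 < lam) (hlam' : lam ≤ 1)
    {m : ℕ} {p : (ZMod 2)[X]} {q : Fin s → (ZMod 2)[X]} (h : IsCBC γ (m + 1) p q) {B : ℝ}
    (hB0 : 0 ≤ B) (hB : weightRatio γ lam ≤ B) {ε : ℝ} (hε : 0 < ε)
    (hm : B ^ lam * ε ^ (-lam) ≤ 2 ^ m) :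
    meanSquareL2 γ (latticePoint (m + 1) p q) ≤ ε * initialMeanSquareL2 γ := by
  have hI : 0 ≤ initialMeanSquareL2 γ := meanSquareL2_nonneg _ _
  have hE := meanSquareL2_nonneg γ (latticePoint (m + 1) p q)
  rw [← Real.rpow_le_rpow_iff hE (mul_nonneg hε.le hI) (by linarith : 0 < lam)]
  refine le_of_mul_le_mul_left (a := (2 : ℝ) ^ m) ?_ (by positivity)
  calc 2 ^ m * meanSquareL2 γ (latticePoint (m + 1) p q) ^ lam
      ≤ (B * initialMeanSquareL2 γ) ^ lam :=
        (h.two_pow_mul_meanSquareL2_rpow_le hγ hlam hlam').trans (weightSum_le hγ hlam hB)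
    _ = B ^ lam * ε ^ (-lam) * (ε * initialMeanSquareL2 γ) ^ lam := by
        rw [Real.mul_rpow hB0 hI, Real.mul_rpow hε.le hI, Real.rpow_neg hε.le]
        field_simp
    _ ≤ 2 ^ m * (ε * initialMeanSquareL2 γ) ^ lam := by gcongr

end

lemma exists_weightRatio_le {γ : (s : ℕ) → Finset (Fin s) → ℝ} {lam : ℝ}
    (hB : weightConst γ lam < ⊤) :
    ∃ B : ℝ, 0 ≤ B ∧ ∀ s, 1 ≤ s → weightRatio (γ s) lam ≤ B := by
  obtain ⟨b, hb, -⟩ := EReal.lt_iff_exists_real_btwn.1 hB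
  refine ⟨max b 0, le_max_right b 0, fun s hs => le_max_of_le_left ?_⟩
  have hle : (weightRatio (γ s) lam : EReal) ≤ weightConst γ lam :=
    le_iSup₂ (f := fun (s : ℕ) (_ : 1 ≤ s) => (weightRatio (γ s) lam : EReal)) s hs
  exact EReal.coe_le_coe_iff.1 (hle.trans hb.le)

end PolyLattice

/-- Strong tractability of the mean square weighted `L₂` discrepancy of CBC-constructed scrambled
polynomial lattice rules, with exponent of tractability at most `λ`. -/
theorem mainTheorem4 (γ : (s : ℕ) → Finset (Fin s) → ℝ) (hγ : ∀ s u, 0 ≤ γ s u)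
    (lam : ℝ) (hlam : 1 / 2 < lam) (hlam' : lam ≤ 1)
    (hB : PolyLattice.weightConst γ lam < ⊤) :
    PolyLattice.StronglyTractable γ lam := by
  obtain ⟨B, hB0, hratio⟩ := PolyLattice.exists_weightRatio_le hB
  refine ⟨by linarith, 2 + 4 * B ^ lam, by positivity, fun s hs p q hcbc ε hε hε1 => ?_⟩
  obtain ⟨N, hN, hNle⟩ := PolyLattice.exists_isLeast_two_pow_le
    (P := fun m => PolyLattice.meanSquareL2 (γ s) (PolyLattice.latticePoint m (p m) (q m)) ≤
      ε * PolyLattice.initialMeanSquareL2 (γ s))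
    (K := B ^ lam * ε ^ (-lam)) (by positivity) fun m hm =>
      (hcbc (m + 1) (by lia)).meanSquareL2_le (hγ s) hlam hlam' hB0 (hratio s hs) hε hm
  have hε' : 1 ≤ ε ^ (-lam) :=
    Real.one_le_rpow_of_pos_of_le_one_of_nonpos hε hε1.le (by linarith)
  refine ⟨N, hN, hNle.trans ?_⟩
  calc 2 + 4 * (B ^ lam * ε ^ (-lam)) ≤ 2 * ε ^ (-lam) + 4 * (B ^ lam * ε ^ (-lam)) := by linarith
    _ = (2 + 4 * B ^ lam) * ε ^ (-lam) := by ring
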